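/- Let $k$ be a field of characteristic $0$ and write $\otimes=\otimes_k$. A double bracket on a unital associative $k$-algebra $A$ is a $k$-bilinear map $\{\!\{-,-\}\!\}:A\times A\to A\otimes A$ with $\{\!\{a,b\}\!\}=-\{\!\{b,a\}\!\}^{\circ}$, where $^\circ$ swaps the two tensor factors, and $\{\!\{a,bc\}\!\}=\{\!\{a,b\}\!\}\,c+b\,\{\!\{a,c\}\!\}$, where $b\,(d'\otimes d'')\,c=bd'\otimes d''c$. It is Poisson if for all $a,b,c\in A$ $$\{\!\{a,\{\!\{b,c\}\!\}'\}\!\}\otimes\{\!\{b,c\}\!\}''+\tau\big(\{\!\{b,\{\!\{c,a\}\!\}'\}\!\}\otimes\{\!\{c,a\}\!\}''\big)+\tau^2\big(\{\!\{c,\{\!\{a,b\}\!\}'\}\!\}\otimes\{\!\{a,b\}\!\}''\big)=0,$$ where $d=d'\otimes d''$ is Sweedler notation for $d\in A\otimes A$ and $\tau(a_1\otimes a_2\otimes a_3)=a_3\otimes a_1\otimes a_2$. An element $\mu\in A$ is a moment map if $\{\!\{\mu,a\}\!\}=a\otimes 1-1\otimes a$ for all $a\in A$. If the double bracket is Poisson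 and $\mu$ is a moment map, then $(A,\{\!\{-,-\}\!\},\mu)$ is called a Hamiltonian algebra, and $\operatorname{HAut}(A)$ denotes the group of $k$-algebra automorphisms $\phi$ of $A$ such that $\{\!\{\phi(a),\phi(b)\}\!\}=(\phi\otimes\phi)\{\!\{a,b\}\!\}$ for all $a,b\in A$, and $\phi(\mu)=\mu$. Let $F_2=k\langle x,y\rangle$ be the free algebra on two generators, with the unique double bracket such that $\{\!\{x,y\}\!\}=1\otimes 1$ and $\{\!\{x,x\}\!\}=0=\{\!\{y,y\}\!\}$, and let $\mu=[x,y]=xy-yx$. Let $A_1=k\langle x,y\rangle/(xy-yx-1)$ be the first Weyl algebra. Then this double bracket is Poisson and $\mu$ is a moment map, so that $F_2$ is a Hamiltonian algebra. Moreover, every $\phi\in\operatorname{HAut}(F_2)$ descends to an automorphism $\bar\phi$ of the $k$-algebra $A_1$, and the resulting group homomorphism $$\operatorname{HAut}(F_2)\to\operatorname{Aut}_k(A_1),\qquad \phi\mapsto\bar\phi,$$ is surjective. -/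

import Mathlib

open scoped TensorProduct

universe u v w

/-- A double bracket on a `k`-algebra `A`: a `k`-bilinear map `A × A → A ⊗ A` which is cyclically
antisymmetric and satisfies the right derivation rule. For `d : A ⊗ A`, the outer bimodule action
`b d c = (b d') ⊗ (d'' c)` is written as the product `(b ⊗ 1) * d * (1 ⊗ c)` in the algebra
`A ⊗ A`. -/
structure DoubleBracket (k : Type u) (A : Type v) [Field k] [Ring A] [Algebra k A] where
  /-- the underlying bilinear map -/
  bracket : A →ₗ[k] A →ₗ[k] A ⊗[k] A
  cyclic_antisymm : ∀ a b : A, bracket a b = -TensorProduct.comm k A A (bracket b a)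
  right_derivation : ∀ a b c : A,
    bracket a (b * c) = bracket a b * (1 ⊗ₜ[k] c) + (b ⊗ₜ[k] 1) * bracket a c

namespace DoubleBracket

section general

variable {k : Type u} {A : Type v} [Field k] [Ring A] [Algebra k A]

/-- The cyclic permutation `a₁ ⊗ a₂ ⊗ a₃ ↦ a₃ ⊗ a₁ ⊗ a₂` of `A ⊗ A ⊗ A`. -/
noncomputable def cyclicPerm (k : Type u) (A : Type v) [Field k] [Ring A] [Algebra k A] :
    (A ⊗[k] A) ⊗[k] A →ₗ[k] (A ⊗[k] A) ⊗[k] A :=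
  (TensorProduct.assoc k A A A).symm.toLinearMap ∘ₗ
    (TensorProduct.comm k (A ⊗[k] A) A).toLinearMap

theorem cyclicPerm_tmul (a b c : A) :
    cyclicPerm k A ((a ⊗ₜ[k] b) ⊗ₜ[k] c) = (c ⊗ₜ[k] a) ⊗ₜ[k] b := by
  simp [cyclicPerm]

/-- The extension `d ↦ {{a, d'}} ⊗ d''` of `{{a, -}}` to `A ⊗ A`. -/
noncomputable def leftExtend (D : DoubleBracket k A) (a : A) :
    A ⊗[k] A →ₗ[k] (A ⊗[k] A) ⊗[k] A :=
  LinearMap.rTensor A (D.bracket a)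

/-- The triple bracket associated with a double bracket. -/
noncomputable def tripleBracket (D : DoubleBracket k A) (a b c : A) : (A ⊗[k] A) ⊗[k] A :=
  D.leftExtend a (D.bracket b c)
    + cyclicPerm k A (D.leftExtend b (D.bracket c a))
    + cyclicPerm k A (cyclicPerm k A (D.leftExtend c (D.bracket a b)))

/-- A double bracket is Poisson if the associated triple bracket vanishes identically. -/
def IsPoisson (D : DoubleBracket k A) : Prop :=
  ∀ a b c : A, D.tripleBracket a b c = 0

/-- Moment maps, in the case where the base ring is `k` itself (so that `1` is the only
idempotent of the base): `{{μ, a}} = a ⊗ 1 - 1 ⊗ a` for all `a`. -/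
def IsMomentMap (D : DoubleBracket k A) (μ : A) : Prop :=
  ∀ a : A, D.bracket μ a = a ⊗ₜ[k] 1 - 1 ⊗ₜ[k] a

/-- An algebra homomorphism is a morphism of double brackets if it intertwines the brackets. -/
def IsMorphism {A' : Type w} [Ring A'] [Algebra k A'] (D : DoubleBracket k A)
    (D' : DoubleBracket k A') (φ : A →ₐ[k] A') : Prop :=
  ∀ a b : A, D'.bracket (φ a) (φ b) = Algebra.TensorProduct.map φ φ (D.bracket a b)

/-- The group `HAut(A)` of automorphisms of a Hamiltonian algebra `(A, D, μ)`: algebra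
automorphisms which are morphisms of double brackets and fix the moment map. -/
def hamiltonianAut (D : DoubleBracket k A) (μ : A) : Subgroup (A ≃ₐ[k] A) where
  carrier := {φ | D.IsMorphism D (φ : A →ₐ[k] A) ∧ φ μ = μ}
  one_mem' := by
    refine ⟨fun a b => ?_, rfl⟩
    have h : ((1 : A ≃ₐ[k] A) : A →ₐ[k] A) = AlgHom.id k A := rfl
    rw [h, Algebra.TensorProduct.map_id]
    rfl
  mul_mem' := by
    rintro φ ψ ⟨hφ, hφμ⟩ ⟨hψ, hψμ⟩
    refine ⟨fun a b => ?_, by rw [AlgEquiv.mul_apply, hψμ, hφμ]⟩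
    have h : ((φ * ψ : A ≃ₐ[k] A) : A →ₐ[k] A) = (φ : A →ₐ[k] A).comp (ψ : A →ₐ[k] A) := rfl
    rw [h, Algebra.TensorProduct.map_comp, AlgHom.comp_apply, AlgHom.comp_apply,
      AlgHom.comp_apply, hφ, hψ]
  inv_mem' := by
    rintro φ ⟨hφ, hφμ⟩
    refine ⟨fun a b => ?_, ?_⟩
    · have h1 : (φ : A →ₐ[k] A) ((φ⁻¹ : A ≃ₐ[k] A) a) = a := φ.apply_symm_apply a
      have h2 : (φ : A →ₐ[k] A) ((φ⁻¹ : A ≃ₐ[k] A) b) = b := φ.apply_symm_apply b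
      have h := hφ ((φ⁻¹ : A ≃ₐ[k] A) a) ((φ⁻¹ : A ≃ₐ[k] A) b)
      rw [h1, h2] at h
      have hid : ((φ⁻¹ : A ≃ₐ[k] A) : A →ₐ[k] A).comp (φ : A →ₐ[k] A) = AlgHom.id k A := by
        ext c
        exact φ.symm_apply_apply c
      rw [h, ← AlgHom.comp_apply, ← Algebra.TensorProduct.map_comp, hid,
        Algebra.TensorProduct.map_id]
      rfl
    · calc (φ⁻¹ : A ≃ₐ[k] A) μ = (φ⁻¹ : A ≃ₐ[k] A) (φ μ) := by rw [hφμ]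
        _ = μ := φ.symm_apply_apply μ

/-- The bilinear map `(p ⊗ q, r ⊗ s) ↦ (r q) ⊗ (p s)`. -/
noncomputable def interchange (k : Type u) (A : Type v) [Field k] [Ring A] [Algebra k A] :
    A ⊗[k] A →ₗ[k] A ⊗[k] A →ₗ[k] A ⊗[k] A :=
  TensorProduct.lift <| LinearMap.mk₂ k
    (fun p q => TensorProduct.map (LinearMap.mulRight k q) (LinearMap.mulLeft k p))
    (by intros; ext; simp [TensorProduct.tmul_add, add_mul])
    (by intros; ext; simp)
    (by intros; ext; simp [TensorProduct.add_tmul, mul_add])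
    (by intros; ext; simp [TensorProduct.smul_tmul'])

theorem interchange_tmul (p q r s : A) :
    interchange k A (p ⊗ₜ[k] q) (r ⊗ₜ[k] s) = (r * q) ⊗ₜ[k] (p * s) := by
  simp [interchange]

theorem interchange_comm (d e : A ⊗[k] A) :
    interchange k A d e = TensorProduct.comm k A A (interchange k A e d) := by
  induction d using TensorProduct.induction_on with
  | zero => simp
  | add d₁ d₂ h₁ h₂ => simp [h₁, h₂]
  | tmul p q =>
    induction e using TensorProduct.induction_on with
    | zero => simp
    | add e₁ e₂ h₁ h₂ => simp [h₁, h₂]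
    | tmul r s => simp [interchange_tmul]

theorem interchange_mul (d e : A ⊗[k] A) (b c : A) :
    interchange k A d ((b ⊗ₜ[k] 1) * e * (1 ⊗ₜ[k] c)) =
      (b ⊗ₜ[k] 1) * interchange k A d e * (1 ⊗ₜ[k] c) := by
  induction d using TensorProduct.induction_on with
  | zero => simp
  | add d₁ d₂ h₁ h₂ => simp [h₁, h₂, mul_add, add_mul]
  | tmul p q =>
    induction e using TensorProduct.induction_on with
    | zero => simp
    | add e₁ e₂ h₁ h₂ => simp [h₁, h₂, mul_add, add_mul]
    | tmul r s => simp [interchange_tmul, mul_assoc]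

/-- The double bracket `{{a, b}} = (∂₂ b)' (∂₁ a)'' ⊗ (∂₁ a)' (∂₂ b)'' - (∂₁ b)' (∂₂ a)'' ⊗ (∂₂ a)' (∂₁ b)''`
associated with two double derivations `∂₁, ∂₂` of `A`. -/
noncomputable def ofDoubleDerivations (d₁ d₂ : A →ₗ[k] A ⊗[k] A)
    (h₁ : ∀ b c, d₁ (b * c) = d₁ b * (1 ⊗ₜ[k] c) + (b ⊗ₜ[k] 1) * d₁ c)
    (h₂ : ∀ b c, d₂ (b * c) = d₂ b * (1 ⊗ₜ[k] c) + (b ⊗ₜ[k] 1) * d₂ c) : DoubleBracket k A where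
  bracket := (interchange k A).compl₁₂ d₁ d₂ - (interchange k A).compl₁₂ d₂ d₁
  cyclic_antisymm a b := by
    simp only [LinearMap.sub_apply, LinearMap.compl₁₂_apply, map_sub, ← interchange_comm]
    abel
  right_derivation a b c := by
    have one_left : ∀ d e : A ⊗[k] A, ∀ c : A,
        interchange k A d (e * (1 ⊗ₜ[k] c)) = interchange k A d e * (1 ⊗ₜ[k] c) := by
      intro d e c
      simpa [← Algebra.TensorProduct.one_def] using interchange_mul d e 1 c
    have one_right : ∀ d e : A ⊗[k] A, ∀ b : A,
        interchange k A d ((b ⊗ₜ[k] 1) * e) = (b ⊗ₜ[k] 1) * interchange k A d e := by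
      intro d e b
      simpa [← Algebra.TensorProduct.one_def] using interchange_mul d e b 1
    simp only [LinearMap.sub_apply, LinearMap.compl₁₂_apply, h₁, h₂, map_add, one_left, one_right,
      sub_mul, mul_sub]
    abel

theorem ofDoubleDerivations_apply (d₁ d₂ : A →ₗ[k] A ⊗[k] A) (h₁ h₂) (a b : A) :
    (ofDoubleDerivations d₁ d₂ h₁ h₂).bracket a b =
      interchange k A (d₁ a) (d₂ b) - interchange k A (d₂ a) (d₁ b) := rfl

end general

end DoubleBracket

/-- The free algebra `F₂ = k⟨x, y⟩`. -/
abbrev F2 (k : Type u) [Field k] : Type u := FreeAlgebra k (Fin 2)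

namespace F2

section construction

variable (k : Type u) [Field k]

/-- The first generator. -/
noncomputable def x : F2 k := FreeAlgebra.ι k 0

/-- The second generator. -/
noncomputable def y : F2 k := FreeAlgebra.ι k 1

/-- The algebra homomorphism `a ↦ (a ⊗ 1, ∂ᵢ a; 0, 1 ⊗ a)` to upper triangular matrices over
`F₂ ⊗ F₂`, which encodes the double derivation `∂ᵢ` with `∂ᵢ (ι j) = δᵢⱼ 1 ⊗ 1`. -/
noncomputable def triangular (i : Fin 2) : F2 k →ₐ[k] Matrix (Fin 2) (Fin 2) (F2 k ⊗[k] F2 k) :=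
  FreeAlgebra.lift k fun j =>
    !![FreeAlgebra.ι k j ⊗ₜ[k] 1, if j = i then 1 ⊗ₜ[k] 1 else 0; 0, 1 ⊗ₜ[k] FreeAlgebra.ι k j]

theorem triangular_diag (i : Fin 2) (a : F2 k) :
    triangular k i a 0 0 = a ⊗ₜ[k] 1 ∧ triangular k i a 1 0 = 0 ∧
      triangular k i a 1 1 = 1 ⊗ₜ[k] a := by
  induction a using FreeAlgebra.induction with
  | grade0 r =>
    simp only [AlgHom.commutes, Matrix.algebraMap_matrix_apply,
      Algebra.TensorProduct.algebraMap_apply]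
    refine ⟨rfl, rfl, ?_⟩
    simp [Algebra.algebraMap_eq_smul_one, TensorProduct.smul_tmul]
  | grade1 j => simp [triangular]
  | mul a b ha hb => simp [Matrix.mul_apply, ha, hb]
  | add a b ha hb => simp [ha, hb, TensorProduct.add_tmul, TensorProduct.tmul_add]

/-- The double derivation `∂ᵢ : F₂ → F₂ ⊗ F₂`; on a word `w` it is the sum of `w' ⊗ w''` over the
factorizations `w = w' (ι i) w''`. -/
noncomputable def partialDeriv (i : Fin 2) : F2 k →ₗ[k] F2 k ⊗[k] F2 k where
  toFun a := triangular k i a 0 1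
  map_add' a b := by simp
  map_smul' r a := by simp

theorem partialDeriv_ι (i j : Fin 2) :
    partialDeriv k i (FreeAlgebra.ι k j) = if j = i then 1 ⊗ₜ[k] 1 else 0 := by
  simp [partialDeriv, triangular]

theorem partialDeriv_mul (i : Fin 2) (a b : F2 k) :
    partialDeriv k i (a * b) =
      partialDeriv k i a * (1 ⊗ₜ[k] b) + (a ⊗ₜ[k] 1) * partialDeriv k i b := by
  obtain ⟨h0, -, -⟩ := triangular_diag k i a
  obtain ⟨-, -, h1⟩ := triangular_diag k i b
  simp [partialDeriv, Matrix.mul_apply, h0, h1, add_comm]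

/-- The double bracket on `F₂ = k⟨x, y⟩` determined by `{{x, y}} = 1 ⊗ 1` and
`{{x, x}} = 0 = {{y, y}}`. -/
noncomputable def bracket : DoubleBracket k (F2 k) :=
  DoubleBracket.ofDoubleDerivations (partialDeriv k 0) (partialDeriv k 1)
    (partialDeriv_mul k 0) (partialDeriv_mul k 1)

theorem bracket_x_y : (bracket k).bracket (x k) (y k) = 1 ⊗ₜ[k] 1 := by
  simp [bracket, DoubleBracket.ofDoubleDerivations_apply, x, y, partialDeriv_ι,
    DoubleBracket.interchange_tmul]

theorem bracket_x_x : (bracket k).bracket (x k) (x k) = 0 := by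
  simp [bracket, DoubleBracket.ofDoubleDerivations_apply, x, partialDeriv_ι]

theorem bracket_y_y : (bracket k).bracket (y k) (y k) = 0 := by
  simp [bracket, DoubleBracket.ofDoubleDerivations_apply, y, partialDeriv_ι]

/-- A double bracket on `F₂` is determined by its values on the generators. -/
theorem bracket_unique (D : DoubleBracket k (F2 k))
    (hxy : D.bracket (x k) (y k) = 1 ⊗ₜ[k] 1) (hxx : D.bracket (x k) (x k) = 0)
    (hyy : D.bracket (y k) (y k) = 0) : D = bracket k := by
  have ext_right : ∀ (D E : DoubleBracket k (F2 k)) (a : F2 k),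
      (∀ j, D.bracket a (FreeAlgebra.ι k j) = E.bracket a (FreeAlgebra.ι k j)) →
      ∀ b, D.bracket a b = E.bracket a b := by
    intro D E a h b
    have one : ∀ D : DoubleBracket k (F2 k), D.bracket a 1 = 0 := by
      intro D
      have := D.right_derivation a 1 1
      rw [← Algebra.TensorProduct.one_def, mul_one, mul_one, one_mul] at this
      exact left_eq_add.mp this
    induction b using FreeAlgebra.induction with
    | grade0 r => simp [Algebra.algebraMap_eq_smul_one, one]
    | grade1 j => exact h j
    | mul b c hb hc => rw [D.right_derivation, E.right_derivation, hb, hc]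
    | add b c hb hc => simp [hb, hc]
  have gen : ∀ i j, D.bracket (FreeAlgebra.ι k i) (FreeAlgebra.ι k j) =
      (bracket k).bracket (FreeAlgebra.ι k i) (FreeAlgebra.ι k j) := by
    intro i j
    fin_cases i <;> fin_cases j
    · exact hxx.trans (bracket_x_x k).symm
    · exact hxy.trans (bracket_x_y k).symm
    · change D.bracket (y k) (x k) = (bracket k).bracket (y k) (x k)
      rw [D.cyclic_antisymm, (bracket k).cyclic_antisymm, hxy, bracket_x_y]
    · exact hyy.trans (bracket_y_y k).symm
  have key : D.bracket = (bracket k).bracket := by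
    ext1 a
    ext1 b
    refine ext_right D _ a (fun j => ?_) b
    rw [D.cyclic_antisymm, (bracket k).cyclic_antisymm]
    rw [ext_right D (bracket k) _ (fun i => gen j i) a]
  generalize bracket k = E at key
  cases D
  cases E
  cases key
  rfl

/-- The moment map `[x, y] = x y - y x`. -/
noncomputable def moment : F2 k := x k * y k - y k * x k

end construction

end F2

/-- The relation `[x, y] - 1 = 0`. -/
inductive Weyl1Rel (k : Type u) [Field k] : F2 k → F2 k → Prop
  | rel : Weyl1Rel k (F2.x k * F2.y k - F2.y k * F2.x k - 1) 0

/-- The first Weyl algebra `A₁ = k⟨x, y⟩ / (x y - y x - 1)`. -/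
abbrev Weyl1 (k : Type u) [Field k] : Type u := RingQuot (Weyl1Rel k)

/-- The projection `F₂ → A₁`. -/
noncomputable def Weyl1.mk (k : Type u) [Field k] : F2 k →ₐ[k] Weyl1 k :=
  RingQuot.mkAlgHom k (Weyl1Rel k)

/-!
Triangular automorphisms `x ↦ α x + β`, `y ↦ α⁻¹ y + q(x)` and the Fourier automorphism `x ↦ y`,
`y ↦ -x` of `F₂` are Hamiltonian, so it suffices to show that their images generate `Aut(A₁)`, which
is a theorem of Dixmier and Makar-Limanov. Let `φ` be an automorphism of `A₁` and `P = φ(x)`. As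
`ad x` is locally nilpotent, so is `ad P`. Passing to leading forms with respect to weights of the
two variables, the Poisson bracket `{f, -}` with the leading form `f` of the symbol of `P` is a
locally nilpotent derivation `D` of `k[X₀, X₁]`, and `deg_T exp(T D)` is a degree function which is
strictly decreased by `D`. Comparing degrees shows that a leading form which is divisible by one
variable does not involve the other one. Hence the Newton polygon of `P` is the triangle with
vertices `0`, `(d₀, 0)` and `(0, d₁)`; moreover one of `d₀`, `d₁` divides the other, and the form on
the edge joining the last two vertices has a rational root, so that a shear lowers one of the two
degrees without raising the other. This descent ends when `P` is a polynomial in `x` or in `y`.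
Since the centralizer of `x` is `k[x]`, the automorphism is then triangular up to the Fourier
automorphism.
-/

namespace DoubleBracket

section derivation

variable {k : Type u} {A : Type v} [Field k] [Ring A] [Algebra k A]

theorem left_derivation (D : DoubleBracket k A) (a b c : A) :
    D.bracket (a * b) c = D.bracket a c * (b ⊗ₜ[k] 1) + (1 ⊗ₜ[k] a) * D.bracket b c := by
  have comm_mul (d e : A ⊗[k] A) : TensorProduct.comm k A A (d * e) =
      TensorProduct.comm k A A d * TensorProduct.comm k A A e :=
    map_mul (Algebra.TensorProduct.comm k A A) d e
  rw [D.cyclic_antisymm, D.right_derivation, map_add, comm_mul, comm_mul, D.cyclic_antisymm a c,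
    D.cyclic_antisymm b c]
  simp only [TensorProduct.comm_tmul, neg_mul, mul_neg]
  abel

theorem bracket_one_right (D : DoubleBracket k A) (a : A) : D.bracket a 1 = 0 := by
  have h := D.right_derivation a 1 1
  rw [← Algebra.TensorProduct.one_def, mul_one, mul_one, one_mul] at h
  exact left_eq_add.mp h

theorem bracket_algebraMap_right (D : DoubleBracket k A) (a : A) (r : k) :
    D.bracket a (algebraMap k A r) = 0 := by
  rw [Algebra.algebraMap_eq_smul_one, map_smul, bracket_one_right, smul_zero]

theorem bracket_eq_zero_symm {D : DoubleBracket k A} {a b : A} (h : D.bracket a b = 0) :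
    D.bracket b a = 0 := by
  rw [D.cyclic_antisymm, h, map_zero, neg_zero]

theorem bracket_algebraMap_left (D : DoubleBracket k A) (r : k) (a : A) :
    D.bracket (algebraMap k A r) a = 0 :=
  bracket_eq_zero_symm (D.bracket_algebraMap_right a r)

theorem bracket_pow (D : DoubleBracket k A) (a b : A) (n : ℕ) :
    D.bracket a (b ^ n) =
      ∑ i ∈ Finset.range n, ((b ^ i) ⊗ₜ[k] 1) * D.bracket a b * (1 ⊗ₜ[k] (b ^ (n - 1 - i))) := by
  induction n with
  | zero => simp [bracket_one_right]
  | succ n ih =>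
    have shift : ∀ i ∈ Finset.range n, b ^ (n - 1 - i) * b = b ^ (n + 1 - 1 - i) := by
      intro i hi
      rw [← pow_succ]
      congr 1
      have := Finset.mem_range.mp hi
      lia
    rw [pow_succ, D.right_derivation, ih, Finset.sum_range_succ, Finset.sum_mul]
    congr 1
    · refine Finset.sum_congr rfl fun i hi => ?_
      rw [mul_assoc, Algebra.TensorProduct.tmul_mul_tmul, one_mul, shift i hi]
    · rw [Nat.add_sub_cancel, Nat.sub_self, pow_zero, ← Algebra.TensorProduct.one_def, mul_one]

open Polynomial

theorem bracket_aeval_right_eq_zero {D : DoubleBracket k A} {a b : A} (h : D.bracket a b = 0)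
    (q : k[X]) : D.bracket a (aeval b q) = 0 := by
  simp [aeval_eq_sum_range, bracket_pow, h]

theorem bracket_aeval_aeval_eq_zero {D : DoubleBracket k A} {a : A} (h : D.bracket a a = 0)
    (p q : k[X]) : D.bracket (aeval a p) (aeval a q) = 0 :=
  bracket_aeval_right_eq_zero
    (bracket_eq_zero_symm (bracket_aeval_right_eq_zero h p)) q

theorem bracket_aeval_left_eq_neg {D : DoubleBracket k A} {a b : A} {r : k}
    (h : D.bracket a b = r • (1 ⊗ₜ[k] 1)) (q : k[X]) :
    D.bracket (aeval b q) a = -D.bracket a (aeval b q) := by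
  have reflect (n : ℕ) :
      TensorProduct.comm k A A (D.bracket a (b ^ n)) = D.bracket a (b ^ n) := by
    have term (i : ℕ) : ((b ^ i) ⊗ₜ[k] 1) * D.bracket a b * (1 ⊗ₜ[k] (b ^ (n - 1 - i))) =
        r • ((b ^ i) ⊗ₜ[k] (b ^ (n - 1 - i))) := by
      simp [h]
    simp only [bracket_pow, term, map_sum, map_smul, TensorProduct.comm_tmul]
    rw [← Finset.sum_range_reflect]
    refine Finset.sum_congr rfl fun i hi => ?_
    rw [Nat.sub_sub_self (Nat.le_sub_one_of_lt (Finset.mem_range.mp hi))]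
  rw [D.cyclic_antisymm, aeval_eq_sum_range]
  simp only [map_sum, map_smul, reflect]

end derivation

section triple

variable {k : Type u} {A : Type v} [Field k] [Ring A] [Algebra k A]

theorem leftExtend_tmul (D : DoubleBracket k A) (a p q : A) :
    D.leftExtend a (p ⊗ₜ[k] q) = D.bracket a p ⊗ₜ[k] q := rfl

theorem cyclicPerm_mul (d e : (A ⊗[k] A) ⊗[k] A) :
    cyclicPerm k A (d * e) = cyclicPerm k A d * cyclicPerm k A e :=
  map_mul ((Algebra.TensorProduct.comm k (A ⊗[k] A) A).trans
    (Algebra.TensorProduct.assoc k k k A A A).symm) d e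

theorem cyclicPerm_cyclicPerm_cyclicPerm (d : (A ⊗[k] A) ⊗[k] A) :
    cyclicPerm k A (cyclicPerm k A (cyclicPerm k A d)) = d := by
  have h : cyclicPerm k A ∘ₗ cyclicPerm k A ∘ₗ cyclicPerm k A = LinearMap.id :=
    TensorProduct.ext_threefold fun a b c => by simp [cyclicPerm_tmul]
  exact LinearMap.congr_fun h d

theorem tripleBracket_cyclic (D : DoubleBracket k A) (a b c : A) :
    D.tripleBracket a b c = cyclicPerm k A (D.tripleBracket b c a) := by
  simp only [tripleBracket, map_add, cyclicPerm_cyclicPerm_cyclicPerm]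
  abel

theorem leftExtend_mul_right (D : DoubleBracket k A) (a d : A) (z : A ⊗[k] A) :
    D.leftExtend a (z * (1 ⊗ₜ[k] d)) = D.leftExtend a z * (1 ⊗ₜ[k] d) := by
  induction z using TensorProduct.induction_on with
  | zero => simp
  | add z₁ z₂ h₁ h₂ => simp [h₁, h₂, add_mul]
  | tmul p q => simp [leftExtend_tmul]

theorem leftExtend_mul_left (D : DoubleBracket k A) (a d : A) (z : A ⊗[k] A) :
    D.leftExtend a ((1 ⊗ₜ[k] d) * z) = (1 ⊗ₜ[k] d) * D.leftExtend a z := by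
  induction z using TensorProduct.induction_on with
  | zero => simp
  | add z₁ z₂ h₁ h₂ => simp [h₁, h₂, mul_add]
  | tmul p q => simp [leftExtend_tmul]

/-- The bilinear map `(a ⊗ b, c ⊗ d) ↦ a ⊗ b c ⊗ d`, which collects the terms of the triple bracket
in which one double bracket is multiplied into a factor of another. -/
noncomputable def concat : A ⊗[k] A →ₗ[k] A ⊗[k] A →ₗ[k] (A ⊗[k] A) ⊗[k] A :=
  (LinearMap.mul k ((A ⊗[k] A) ⊗[k] A)).compl₁₂
    Algebra.TensorProduct.includeLeft.toLinearMap
    ((Algebra.TensorProduct.assoc k k k A A A).symm.toLinearMap ∘ₗ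
      Algebra.TensorProduct.includeRight.toLinearMap)

theorem concat_tmul_right (d : A ⊗[k] A) (p q : A) :
    concat d (p ⊗ₜ[k] q) = (d * (1 ⊗ₜ[k] p)) ⊗ₜ[k] q := by
  simp [concat]

theorem leftExtend_tmul_one_mul (D : DoubleBracket k A) (a c : A) (z : A ⊗[k] A) :
    D.leftExtend a ((c ⊗ₜ[k] 1) * z) =
      concat (D.bracket a c) z + ((c ⊗ₜ[k] 1) ⊗ₜ[k] 1) * D.leftExtend a z := by
  induction z using TensorProduct.induction_on with
  | zero => simp
  | add z₁ z₂ h₁ h₂ => simp only [h₁, h₂, mul_add, map_add]; abel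
  | tmul p q =>
    simp [leftExtend_tmul, concat_tmul_right, D.right_derivation, TensorProduct.add_tmul]

theorem cyclicPerm_tmul_one_mul_tmul (p q : A) (e : A ⊗[k] A) :
    cyclicPerm k A (((p ⊗ₜ[k] 1) * e) ⊗ₜ[k] q) = concat (q ⊗ₜ[k] p) e := by
  induction e using TensorProduct.induction_on with
  | zero => simp
  | add e₁ e₂ h₁ h₂ => simp only [h₁, h₂, mul_add, map_add, TensorProduct.add_tmul]
  | tmul r s => simp [concat_tmul_right, cyclicPerm_tmul]

theorem cyclicPerm_leftExtend_mul_tmul_one (D : DoubleBracket k A) (b d : A) (z : A ⊗[k] A) :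
    cyclicPerm k A (D.leftExtend b (z * (d ⊗ₜ[k] 1))) =
      cyclicPerm k A (D.leftExtend b z) * (1 ⊗ₜ[k] d) +
        concat (TensorProduct.comm k A A z) (D.bracket b d) := by
  induction z using TensorProduct.induction_on with
  | zero => simp
  | add z₁ z₂ h₁ h₂ => simp only [h₁, h₂, add_mul, map_add, LinearMap.add_apply]; abel
  | tmul p q =>
    have factor : (D.bracket b p * (1 ⊗ₜ[k] d)) ⊗ₜ[k] q =
        (D.bracket b p ⊗ₜ[k] q) * ((1 ⊗ₜ[k] d) ⊗ₜ[k] 1) := by simp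
    rw [Algebra.TensorProduct.tmul_mul_tmul, mul_one, leftExtend_tmul, leftExtend_tmul,
      D.right_derivation, TensorProduct.add_tmul, map_add, cyclicPerm_tmul_one_mul_tmul, factor,
      cyclicPerm_mul, cyclicPerm_tmul, TensorProduct.comm_tmul, ← Algebra.TensorProduct.one_def]

theorem leftExtend_mul (D : DoubleBracket k A) (c d : A) (z : A ⊗[k] A) :
    D.leftExtend (c * d) z =
      D.leftExtend c z * ((d ⊗ₜ[k] 1) ⊗ₜ[k] 1) + ((1 ⊗ₜ[k] c) ⊗ₜ[k] 1) * D.leftExtend d z := by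
  induction z using TensorProduct.induction_on with
  | zero => simp
  | add z₁ z₂ h₁ h₂ => simp only [h₁, h₂, map_add, add_mul, mul_add]; abel
  | tmul p q => simp [leftExtend_tmul, D.left_derivation, TensorProduct.add_tmul]

-- The `concat` terms from the first two summands cancel, by the antisymmetry of the bracket.
theorem tripleBracket_mul (D : DoubleBracket k A) (a b c d : A) :
    D.tripleBracket a b (c * d) = D.tripleBracket a b c * (1 ⊗ₜ[k] d) +
      ((c ⊗ₜ[k] 1) ⊗ₜ[k] 1) * D.tripleBracket a b d := by
  simp only [tripleBracket]
  rw [D.right_derivation, D.left_derivation, map_add, map_add, leftExtend_mul_right,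
    leftExtend_tmul_one_mul, map_add, cyclicPerm_leftExtend_mul_tmul_one, leftExtend_mul_left,
    leftExtend_mul, cyclicPerm_mul, map_add, map_add, D.cyclic_antisymm a c, map_neg,
    LinearMap.neg_apply]
  simp only [cyclicPerm_mul, cyclicPerm_tmul, Algebra.TensorProduct.one_def, add_mul, mul_add]
  abel

theorem tripleBracket_add (D : DoubleBracket k A) (a b c d : A) :
    D.tripleBracket a b (c + d) = D.tripleBracket a b c + D.tripleBracket a b d := by
  simp only [tripleBracket, leftExtend, map_add, LinearMap.add_apply, LinearMap.rTensor_add]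
  abel

theorem tripleBracket_algebraMap (D : DoubleBracket k A) (a b : A) (r : k) :
    D.tripleBracket a b (algebraMap k A r) = 0 := by
  have h : D.bracket (algebraMap k A r) = 0 := LinearMap.ext (D.bracket_algebraMap_left r)
  simp [tripleBracket, leftExtend, bracket_algebraMap_right, h]

end triple

section generators

variable {k : Type u} {A : Type v} [Field k] [Ring A] [Algebra k A] {S : Set A}

theorem tripleBracket_eq_zero_of_adjoin (hS : Algebra.adjoin k S = ⊤) {D : DoubleBracket k A}
    {a b : A} (h : ∀ s ∈ S, D.tripleBracket a b s = 0) (c : A) : D.tripleBracket a b c = 0 := by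
  induction (hS ▸ Algebra.mem_top : c ∈ Algebra.adjoin k S) using Algebra.adjoin_induction with
  | mem s hs => exact h s hs
  | algebraMap r => exact D.tripleBracket_algebraMap a b r
  | add c d _ _ hc hd => rw [tripleBracket_add, hc, hd, add_zero]
  | mul c d _ _ hc hd => rw [tripleBracket_mul, hc, hd, zero_mul, mul_zero, add_zero]

theorem isPoisson_of_adjoin (hS : Algebra.adjoin k S = ⊤) {D : DoubleBracket k A}
    (h : ∀ a ∈ S, ∀ b ∈ S, ∀ c ∈ S, D.tripleBracket a b c = 0) : D.IsPoisson := by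
  have rotate {a b c : A} (h : D.tripleBracket a b c = 0) : D.tripleBracket c a b = 0 := by
    rw [tripleBracket_cyclic, h, map_zero]
  have extend (a : A) (ha : a ∈ S) (c d : A) : D.tripleBracket c a d = 0 :=
    tripleBracket_eq_zero_of_adjoin hS
      (fun s hs => rotate (tripleBracket_eq_zero_of_adjoin hS (h a ha s hs) c)) d
  exact fun a b => tripleBracket_eq_zero_of_adjoin hS fun s hs => rotate (extend s hs b a)

theorem isMomentMap_of_adjoin (hS : Algebra.adjoin k S = ⊤) {D : DoubleBracket k A} {μ : A}
    (h : ∀ s ∈ S, D.bracket μ s = s ⊗ₜ[k] 1 - 1 ⊗ₜ[k] s) : D.IsMomentMap μ := by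
  intro a
  induction (hS ▸ Algebra.mem_top : a ∈ Algebra.adjoin k S) using Algebra.adjoin_induction with
  | mem s hs => exact h s hs
  | algebraMap r =>
    rw [bracket_algebraMap_right, Algebra.algebraMap_eq_smul_one, TensorProduct.smul_tmul, sub_self]
  | add a b _ _ ha hb =>
    rw [map_add, ha, hb, TensorProduct.add_tmul, TensorProduct.tmul_add]
    abel
  | mul a b _ _ ha hb =>
    rw [right_derivation, ha, hb]
    simp [sub_mul, mul_sub]

variable {B : Type w} [Ring B] [Algebra k B] {D : DoubleBracket k A} {E : DoubleBracket k B}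
  {φ : A →ₐ[k] B}

theorem bracket_map_of_adjoin (hS : Algebra.adjoin k S = ⊤) {a : A}
    (h : ∀ s ∈ S, E.bracket (φ a) (φ s) = Algebra.TensorProduct.map φ φ (D.bracket a s)) (b : A) :
    E.bracket (φ a) (φ b) = Algebra.TensorProduct.map φ φ (D.bracket a b) := by
  induction (hS ▸ Algebra.mem_top : b ∈ Algebra.adjoin k S) using Algebra.adjoin_induction with
  | mem s hs => exact h s hs
  | algebraMap r =>
    rw [AlgHom.commutes, bracket_algebraMap_right, bracket_algebraMap_right, map_zero]
  | add b c _ _ hb hc => rw [map_add, map_add, map_add, map_add, hb, hc]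
  | mul b c _ _ hb hc =>
    rw [map_mul, right_derivation, right_derivation, hb, hc]
    simp

theorem bracket_map_symm {a b : A}
    (h : E.bracket (φ a) (φ b) = Algebra.TensorProduct.map φ φ (D.bracket a b)) :
    E.bracket (φ b) (φ a) = Algebra.TensorProduct.map φ φ (D.bracket b a) := by
  rw [E.cyclic_antisymm, D.cyclic_antisymm, h, map_neg]
  exact congrArg Neg.neg (TensorProduct.map_comm φ.toLinearMap φ.toLinearMap _).symm

theorem isMorphism_of_adjoin (hS : Algebra.adjoin k S = ⊤)
    (h : ∀ a ∈ S, ∀ b ∈ S,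
      E.bracket (φ a) (φ b) = Algebra.TensorProduct.map φ φ (D.bracket a b)) :
    D.IsMorphism E φ := fun a b =>
  bracket_map_of_adjoin hS (fun s hs =>
    bracket_map_symm (bracket_map_of_adjoin hS (h s hs) a)) b

end generators

end DoubleBracket

namespace F2

section hamiltonian

variable (k : Type u) [Field k]

theorem adjoin_x_y : Algebra.adjoin k {x k, y k} = ⊤ := by
  have range_ι : Set.range (FreeAlgebra.ι k) = {x k, y k} := by
    ext a
    simp [Fin.exists_fin_two, eq_comm, x, y]
  rw [← range_ι, FreeAlgebra.adjoin_range_ι]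

theorem bracket_y_x : (bracket k).bracket (y k) (x k) = -(1 ⊗ₜ[k] 1) := by
  rw [(bracket k).cyclic_antisymm, bracket_x_y, TensorProduct.comm_tmul]

theorem isPoisson_bracket : (bracket k).IsPoisson := by
  have leftExtend_one (a : F2 k) : (bracket k).leftExtend a (1 ⊗ₜ[k] 1) = 0 := by
    rw [DoubleBracket.leftExtend_tmul, DoubleBracket.bracket_one_right, TensorProduct.zero_tmul]
  refine DoubleBracket.isPoisson_of_adjoin (adjoin_x_y k) ?_
  rintro a (rfl | rfl) b (rfl | rfl) c (rfl | rfl) <;>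
    simp [DoubleBracket.tripleBracket, bracket_x_x, bracket_x_y, bracket_y_x, bracket_y_y,
      leftExtend_one]

theorem isMomentMap_moment : (bracket k).IsMomentMap (moment k) := by
  refine DoubleBracket.isMomentMap_of_adjoin (adjoin_x_y k) ?_
  have expand (a : F2 k) : (bracket k).bracket (moment k) a =
      (bracket k).bracket (x k) a * (y k ⊗ₜ 1) + (1 ⊗ₜ x k) * (bracket k).bracket (y k) a -
        ((bracket k).bracket (y k) a * (x k ⊗ₜ 1) + (1 ⊗ₜ y k) * (bracket k).bracket (x k) a) := by
    rw [moment, map_sub, LinearMap.sub_apply, DoubleBracket.left_derivation,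
      DoubleBracket.left_derivation]
  rintro a (rfl | rfl)
  · rw [expand, bracket_x_x, bracket_y_x, ← TensorProduct.neg_tmul, zero_mul, mul_zero, zero_add,
      add_zero, Algebra.TensorProduct.tmul_mul_tmul, Algebra.TensorProduct.tmul_mul_tmul, one_mul,
      mul_one, mul_one, neg_one_mul, TensorProduct.neg_tmul, TensorProduct.neg_tmul,
      sub_neg_eq_add, neg_add_eq_sub]
  · simp [expand, bracket_x_y, bracket_y_y]

variable {k}

theorem mem_hamiltonianAut {φ : F2 k ≃ₐ[k] F2 k} (hμ : φ (moment k) = moment k)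
    (hxy : (bracket k).bracket (φ (x k)) (φ (y k)) = 1 ⊗ₜ[k] 1)
    (hxx : (bracket k).bracket (φ (x k)) (φ (x k)) = 0)
    (hyy : (bracket k).bracket (φ (y k)) (φ (y k)) = 0) :
    φ ∈ (bracket k).hamiltonianAut (moment k) := by
  have hyx : (bracket k).bracket (φ (y k)) (φ (x k)) = -(1 ⊗ₜ[k] 1) := by
    rw [(bracket k).cyclic_antisymm, hxy, TensorProduct.comm_tmul]
  refine ⟨DoubleBracket.isMorphism_of_adjoin (adjoin_x_y k) ?_, hμ⟩
  rintro a (rfl | rfl) b (rfl | rfl) <;>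
    simp [hxx, hxy, hyx, hyy, bracket_x_x, bracket_x_y, bracket_y_x, bracket_y_y]

end hamiltonian

section automorphisms

variable {k : Type u} [Field k]

section lift

variable {B : Type v} [Semiring B] [Algebra k B]

/-- The algebra homomorphism out of `F₂` with given values on `x` and `y`. -/
noncomputable def hom (a b : B) : F2 k →ₐ[k] B :=
  FreeAlgebra.lift k ![a, b]

@[simp] theorem hom_x (a b : B) : hom a b (x k) = a := by simp [hom, x]

@[simp] theorem hom_y (a b : B) : hom a b (y k) = b := by simp [hom, y]

theorem hom_ext {f g : F2 k →ₐ[k] B} (hx : f (x k) = g (x k)) (hy : f (y k) = g (y k)) : f = g :=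
  AlgHom.ext_of_adjoin_eq_top (adjoin_x_y k) (by rintro a (rfl | rfl) <;> assumption)

end lift

/-- The automorphism `x ↦ y`, `y ↦ -x` of `F₂`. -/
noncomputable def fourier : F2 k ≃ₐ[k] F2 k :=
  AlgEquiv.ofAlgHom (hom (y k) (-x k)) (hom (-y k) (x k))
    (hom_ext (by simp) (by simp)) (hom_ext (by simp) (by simp))

theorem fourier_x : fourier (x k) = y k := hom_x _ _

theorem fourier_y : fourier (y k) = -x k := hom_y _ _

theorem fourier_mem_hamiltonianAut :
    (fourier : F2 k ≃ₐ[k] F2 k) ∈ (bracket k).hamiltonianAut (moment k) := by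
  refine mem_hamiltonianAut ?_ ?_ ?_ ?_ <;>
    simp only [moment, map_sub, map_mul, fourier_x, fourier_y, map_neg, LinearMap.neg_apply,
      bracket_x_x, bracket_y_y, bracket_y_x, neg_neg, neg_zero]
  rw [mul_neg, neg_mul, sub_neg_eq_add, neg_add_eq_sub]

open Polynomial

/-- The automorphism `x ↦ α x + β`, `y ↦ α⁻¹ y + q(x)` of `F₂`. -/
noncomputable def triangularAut (α : kˣ) (β : k) (q : k[X]) : F2 k ≃ₐ[k] F2 k :=
  AlgEquiv.ofAlgHom
    (hom ((α : k) • x k + algebraMap k _ β) ((↑α⁻¹ : k) • y k + aeval (x k) q))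
    (hom ((↑α⁻¹ : k) • (x k - algebraMap k _ β))
      ((α : k) • (y k - aeval ((↑α⁻¹ : k) • (x k - algebraMap k _ β)) q)))
    (hom_ext (by simp [smul_smul]) (by simp [smul_smul, ← aeval_algHom_apply]))
    (hom_ext (by simp [smul_smul]) (by simp [smul_smul, ← aeval_algHom_apply]))

theorem triangularAut_x (α : kˣ) (β : k) (q : k[X]) :
    triangularAut α β q (x k) = (α : k) • x k + algebraMap k _ β := hom_x _ _

theorem triangularAut_y (α : kˣ) (β : k) (q : k[X]) :
    triangularAut α β q (y k) = (↑α⁻¹ : k) • y k + aeval (x k) q := hom_y _ _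

theorem triangularAut_moment (α : kˣ) (β : k) (q : k[X]) :
    triangularAut α β q (moment k) = moment k := by
  have commute : x k * aeval (x k) q = aeval (x k) q * x k := by
    simpa using congrArg (aeval (x k)) (mul_comm X q)
  simp only [moment, map_sub, map_mul, triangularAut_x, triangularAut_y,
    Algebra.algebraMap_eq_smul_one, mul_add, add_mul, commute, one_mul, mul_one, smul_mul_assoc,
    mul_smul_comm, smul_add, smul_smul, Units.mul_inv, Units.inv_mul, one_smul]
  rw [mul_comm β]
  abel

theorem triangularAut_mem_hamiltonianAut (α : kˣ) (β : k) (q : k[X]) :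
    triangularAut α β q ∈ (bracket k).hamiltonianAut (moment k) := by
  have bracket_x_aeval : (bracket k).bracket (x k) (aeval (x k) q) = 0 :=
    DoubleBracket.bracket_aeval_right_eq_zero (bracket_x_x k) q
  have bracket_aeval_y : (bracket k).bracket (aeval (x k) q) (y k) =
      -(bracket k).bracket (y k) (aeval (x k) q) :=
    DoubleBracket.bracket_aeval_left_eq_neg (r := -1) (by simp [bracket_y_x]) q
  refine mem_hamiltonianAut (triangularAut_moment α β q) ?_ ?_ ?_ <;>
    simp [triangularAut_x, triangularAut_y, DoubleBracket.bracket_algebraMap_left,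
      DoubleBracket.bracket_algebraMap_right, bracket_x_y, bracket_x_x, bracket_y_y,
      bracket_x_aeval, bracket_aeval_y,
      DoubleBracket.bracket_aeval_aeval_eq_zero (bracket_x_x k), smul_smul]

end automorphisms

end F2

namespace Weyl1

section presentation

variable (k : Type u) [Field k]

/-- The first generator of `A₁`. -/
noncomputable def x : Weyl1 k := mk k (F2.x k)

/-- The second generator of `A₁`. -/
noncomputable def y : Weyl1 k := mk k (F2.y k)

theorem mk_surjective : Function.Surjective (mk k) := RingQuot.mkAlgHom_surjective k _

theorem mk_moment : mk k (F2.moment k) = 1 := by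
  have h := RingQuot.mkAlgHom_rel k (Weyl1Rel.rel (k := k))
  rw [map_zero, map_sub, map_one] at h
  exact sub_eq_zero.mp h

theorem x_mul_y : x k * y k = y k * x k + 1 := by
  have h := mk_moment k
  rw [F2.moment, map_sub, map_mul, map_mul] at h
  exact eq_add_of_sub_eq' h

theorem adjoin_x_y : Algebra.adjoin k {x k, y k} = ⊤ := by
  rw [← (AlgHom.range_eq_top (mk k)).mpr (mk_surjective k), ← Algebra.map_top, ← F2.adjoin_x_y,
    AlgHom.map_adjoin, Set.image_pair, x, y]

variable {k}

@[elab_as_elim]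
theorem induction {C : Weyl1 k → Prop} (algebraMap : ∀ r, C (algebraMap k _ r)) (x : C (x k))
    (y : C (y k)) (mul : ∀ a b, C a → C b → C (a * b)) (add : ∀ a b, C a → C b → C (a + b))
    (a : Weyl1 k) : C a := by
  have ha : a ∈ Algebra.adjoin k {Weyl1.x k, Weyl1.y k} := adjoin_x_y k ▸ Algebra.mem_top
  induction ha using Algebra.adjoin_induction with
  | mem s hs => rcases hs with rfl | rfl <;> assumption
  | algebraMap r => exact algebraMap r
  | add a b _ _ ha hb => exact add a b ha hb
  | mul a b _ _ ha hb => exact mul a b ha hb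

section hom

variable {B : Type v} [Ring B] [Algebra k B]

/-- The algebra homomorphism from `A₁` given by two elements with commutator `1`. -/
noncomputable def hom (a b : B) (h : a * b - b * a = 1) : Weyl1 k →ₐ[k] B :=
  RingQuot.liftAlgHom k ⟨F2.hom a b, by rintro _ _ ⟨⟩; simp [h]⟩

@[simp] theorem hom_mk (a b : B) (h : a * b - b * a = 1) (c : F2 k) :
    hom a b h (mk k c) = F2.hom a b c :=
  RingQuot.liftAlgHom_mkAlgHom_apply _ _ _ _

@[simp] theorem hom_x (a b : B) (h : a * b - b * a = 1) : hom a b h (x k) = a := by simp [x]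

@[simp] theorem hom_y (a b : B) (h : a * b - b * a = 1) : hom a b h (y k) = b := by simp [y]

theorem hom_ext {f g : Weyl1 k →ₐ[k] B} (hx : f (x k) = g (x k)) (hy : f (y k) = g (y k)) :
    f = g :=
  RingQuot.ringQuot_ext' k _ _ (F2.hom_ext hx hy)

end hom

end presentation

section descent

variable {k : Type u} [Field k]

/-- The endomorphism of `A₁` induced by an endomorphism of `F₂` which fixes `[x, y]`. -/
noncomputable def map (φ : F2 k →ₐ[k] F2 k) (h : φ (F2.moment k) = F2.moment k) :
    Weyl1 k →ₐ[k] Weyl1 k :=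
  hom (mk k (φ (F2.x k))) (mk k (φ (F2.y k))) (by
    rw [← mk_moment, ← h, F2.moment]
    simp)

theorem map_mk (φ : F2 k →ₐ[k] F2 k) (h : φ (F2.moment k) = F2.moment k) (a : F2 k) :
    map φ h (mk k a) = mk k (φ a) := by
  rw [map, hom_mk]
  exact DFunLike.congr_fun (F2.hom_ext (g := (mk k).comp φ) (by simp) (by simp)) a

variable (k) in
/-- The homomorphism from `HAut(F₂)` to the monoid of endomorphisms of `A₁`. -/
noncomputable def descendEnd :
    (F2.bracket k).hamiltonianAut (F2.moment k) →* (Weyl1 k →ₐ[k] Weyl1 k) where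
  toFun φ := map (φ : F2 k ≃ₐ[k] F2 k) φ.2.2
  map_one' := hom_ext (map_mk _ _ _) (map_mk _ _ _)
  map_mul' φ ψ := by
    refine AlgHom.ext fun a => ?_
    obtain ⟨a, rfl⟩ := mk_surjective k a
    refine (map_mk _ (φ * ψ).2.2 a).trans ?_
    rw [AlgHom.mul_apply, map_mk _ ψ.2.2, map_mk _ φ.2.2]
    rfl

variable (k) in
/-- The homomorphism `HAut(F₂) → Aut(A₁)`. -/
noncomputable def descend :
    (F2.bracket k).hamiltonianAut (F2.moment k) →* (Weyl1 k ≃ₐ[k] Weyl1 k) :=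
  (AlgEquiv.algHomUnitsEquiv k (Weyl1 k)).toMonoidHom.comp (descendEnd k).toHomUnits

theorem descend_mk (φ : (F2.bracket k).hamiltonianAut (F2.moment k)) (a : F2 k) :
    descend k φ (mk k a) = mk k ((φ : F2 k ≃ₐ[k] F2 k) a) :=
  map_mk _ φ.2.2 a

end descent

end Weyl1

theorem pderiv_pderiv_comm {σ : Type v} {R : Type u} [CommRing R] (i j : σ)
    (f : MvPolynomial σ R) :
    MvPolynomial.pderiv i (MvPolynomial.pderiv j f) =
      MvPolynomial.pderiv j (MvPolynomial.pderiv i f) := by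
  ext m
  simp only [MvPolynomial.coeff_pderiv, add_right_comm m]
  rcases eq_or_ne i j with rfl | hij
  · rfl
  · simp [hij, hij.symm, mul_right_comm]

namespace Weyl1

section symbol

open MvPolynomial

variable {k : Type u} [Field k]

variable (k) in
/-- The action of `A₁` on `k[X₀, X₁]` which corresponds to left multiplication on normally ordered
polynomials: `x` acts as `X₀` and `y` as `X₁ - ∂₀`. -/
noncomputable def act : Weyl1 k →ₐ[k] Module.End k (MvPolynomial (Fin 2) k) :=
  hom (LinearMap.mulLeft k (X 0)) (LinearMap.mulLeft k (X 1) - (pderiv 0).toLinearMap) <|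
    LinearMap.ext fun g => by
      simp only [LinearMap.sub_apply, Module.End.mul_apply, LinearMap.mulLeft_apply,
        Derivation.coeFn_coe, pderiv_mul, pderiv_X_self, Module.End.one_apply]
      ring

theorem act_x (g : MvPolynomial (Fin 2) k) : act k (x k) g = X 0 * g := by
  simp [act]

theorem act_y (g : MvPolynomial (Fin 2) k) : act k (y k) g = X 1 * g - pderiv 0 g := by
  simp [act]

theorem act_x_pow (n : ℕ) (g : MvPolynomial (Fin 2) k) : act k (x k ^ n) g = X 0 ^ n * g := by
  induction n with
  | zero => simp
  | succ n ih => rw [pow_succ', map_mul, Module.End.mul_apply, ih, act_x, pow_succ', mul_assoc]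

theorem act_y_pow_one (n : ℕ) : act k (y k ^ n) 1 = X 1 ^ n := by
  induction n with
  | zero => simp
  | succ n ih =>
    rw [pow_succ', map_mul, Module.End.mul_apply, ih, act_y, pderiv_pow,
      pderiv_X_of_ne (by decide), mul_zero, sub_zero, ← pow_succ']

variable (k) in
/-- The linear map `X₀ ^ i * X₁ ^ j ↦ x ^ i * y ^ j`. -/
noncomputable def normalOrder : MvPolynomial (Fin 2) k →ₗ[k] Weyl1 k :=
  (basisMonomials (Fin 2) k).constr k fun m => x k ^ m 0 * y k ^ m 1

theorem normalOrder_monomial (m : Fin 2 →₀ ℕ) (r : k) :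
    normalOrder k (monomial m r) = r • (x k ^ m 0 * y k ^ m 1) := by
  have h : monomial m r = r • basisMonomials (Fin 2) k m := by simp [smul_monomial]
  rw [h, map_smul, normalOrder, Module.Basis.constr_basis]

theorem y_mul_x_pow (n : ℕ) : y k * x k ^ n = x k ^ n * y k - n • x k ^ (n - 1) := by
  induction n with
  | zero => simp
  | succ n ih =>
    have absorb : n • x k ^ (n - 1) * x k = n • x k ^ n := by
      rcases n with _ | n <;> simp [pow_succ, add_mul, mul_assoc]
    rw [pow_succ, ← mul_assoc, ih, sub_mul, absorb, mul_assoc, mul_assoc, x_mul_y, mul_add,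
      Nat.add_sub_cancel, succ_nsmul, mul_one]
    abel

theorem normalOrder_X_zero_mul (g : MvPolynomial (Fin 2) k) :
    normalOrder k (X 0 * g) = x k * normalOrder k g := by
  induction g using MvPolynomial.induction_on' with
  | monomial m r =>
    rw [X, monomial_mul, normalOrder_monomial, normalOrder_monomial, mul_smul_comm, ← mul_assoc]
    simp [pow_add]
  | add p q hp hq => rw [mul_add, map_add, map_add, hp, hq, mul_add]

theorem normalOrder_X_one_mul_sub (g : MvPolynomial (Fin 2) k) :
    normalOrder k (X 1 * g - pderiv 0 g) = y k * normalOrder k g := by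
  induction g using MvPolynomial.induction_on' with
  | monomial m r =>
    rw [X, monomial_mul, pderiv_monomial, map_sub, normalOrder_monomial, normalOrder_monomial,
      normalOrder_monomial, mul_smul_comm, ← mul_assoc, y_mul_x_pow]
    simp [pow_add, sub_mul, smul_sub, mul_assoc, mul_smul, Nat.cast_smul_eq_nsmul,
      (Commute.refl (y k)).pow_right (m 1) |>.eq]
  | add p q hp hq =>
    rw [mul_add, map_add, add_sub_add_comm, map_add, hp, hq, map_add, mul_add]

theorem normalOrder_act (a : Weyl1 k) (g : MvPolynomial (Fin 2) k) :
    normalOrder k (act k a g) = a * normalOrder k g := by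
  induction a using Weyl1.induction generalizing g with
  | algebraMap r => rw [AlgHom.commutes, Module.algebraMap_end_apply, map_smul, Algebra.smul_def]
  | x => rw [act_x, normalOrder_X_zero_mul]
  | y => rw [act_y, normalOrder_X_one_mul_sub]
  | mul a b ha hb => rw [map_mul, Module.End.mul_apply, ha, hb, mul_assoc]
  | add a b ha hb => rw [map_add, LinearMap.add_apply, map_add, ha, hb, add_mul]

theorem act_normalOrder_one (g : MvPolynomial (Fin 2) k) : act k (normalOrder k g) 1 = g := by
  induction g using MvPolynomial.induction_on' with
  | monomial m r =>
    rw [normalOrder_monomial, map_smul, LinearMap.smul_apply, map_mul, Module.End.mul_apply,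
      act_y_pow_one, act_x_pow, monomial_eq, Finsupp.prod_fintype _ _ (by simp),
      Fin.prod_univ_two, smul_eq_C_mul]
  | add p q hp hq => rw [map_add, map_add, LinearMap.add_apply, hp, hq]

theorem normalOrder_one : normalOrder k 1 = 1 := by
  rw [← C_1, C_apply, normalOrder_monomial]
  simp

variable (k) in
/-- The normally ordered symbol of an element of `A₁`, which sends `x ^ i * y ^ j` to
`X₀ ^ i * X₁ ^ j`; it is obtained by letting `A₁` act on `1`. -/
noncomputable def symbol : Weyl1 k ≃ₗ[k] MvPolynomial (Fin 2) k :=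
  LinearEquiv.ofLinearMap ((LinearMap.applyₗ 1).comp (act k).toLinearMap) (normalOrder k)
    (LinearMap.ext act_normalOrder_one)
    (LinearMap.ext fun a => (normalOrder_act a 1).trans (by simp [normalOrder_one]))

theorem symbol_apply (a : Weyl1 k) : symbol k a = act k a 1 := rfl

theorem symbol_symm_monomial (m : Fin 2 →₀ ℕ) (r : k) :
    (symbol k).symm (monomial m r) = r • (x k ^ m 0 * y k ^ m 1) :=
  normalOrder_monomial m r

theorem symbol_mul (a b : Weyl1 k) : symbol k (a * b) = act k a (symbol k b) := by
  simp [symbol_apply]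

theorem symbol_x_mul (a : Weyl1 k) : symbol k (x k * a) = X 0 * symbol k a := by
  rw [symbol_mul, act_x]

theorem symbol_x : symbol k (x k) = X 0 := by simp [symbol_apply, act_x]

theorem symbol_y : symbol k (y k) = X 1 := by simp [symbol_apply, act_y]

theorem symbol_algebraMap (r : k) : symbol k (algebraMap k _ r) = C r := by
  simp [symbol_apply, smul_eq_C_mul]

-- Right multiplication by `x` corresponds to `X₀ - ∂₁`, which commutes with the left action.
theorem symbol_mul_x (a : Weyl1 k) :
    symbol k (a * x k) = X 0 * symbol k a - pderiv 1 (symbol k a) := by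
  have commute (g : MvPolynomial (Fin 2) k) :
      act k a (X 0 * g - pderiv 1 g) = X 0 * act k a g - pderiv 1 (act k a g) := by
    induction a using Weyl1.induction generalizing g with
    | algebraMap r => simp [smul_sub]
    | x =>
      simp only [act_x, pderiv_mul, pderiv_X_of_ne (show (0 : Fin 2) ≠ 1 by decide)]
      ring
    | y =>
      simp only [act_y, mul_sub, map_sub, pderiv_mul, pderiv_X_self,
        pderiv_pderiv_comm (1 : Fin 2) 0]
      ring
    | mul a b ha hb => rw [map_mul, Module.End.mul_apply, hb, ha, Module.End.mul_apply]
    | add a b ha hb =>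
      simp only [map_add, LinearMap.add_apply, ha, hb]
      ring
  rw [symbol_mul, symbol_x]
  simpa [symbol_apply] using commute 1

end symbol

end Weyl1

section weights

open MvPolynomial

variable {σ : Type v} {R : Type u} [CommRing R] {w : σ → ℤ} {m n : ℤ}

variable (R w n) in
/-- The polynomials all of whose monomials have weight at most `n`: the increasing filtration of
`R[σ]` which is attached to integral weights of the variables. -/
noncomputable def weightLE : Submodule R (MvPolynomial σ R) :=
  restrictSupport R {d | Finsupp.weight w d ≤ n}

theorem mem_weightLE {f : MvPolynomial σ R} :
    f ∈ weightLE R w n ↔ ∀ d, coeff d f ≠ 0 → Finsupp.weight w d ≤ n := by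
  simp only [weightLE, mem_restrictSupport_iff, Set.subset_def, Finset.mem_coe, mem_support_iff,
    Set.mem_ofPred_eq]

theorem weightLE_mono (h : m ≤ n) : weightLE R w m ≤ weightLE R w n :=
  restrictSupport_mono R fun _ hd => le_trans hd h

theorem mul_mem_weightLE {f g : MvPolynomial σ R} (hf : f ∈ weightLE R w m)
    (hg : g ∈ weightLE R w n) : f * g ∈ weightLE R w (m + n) := by
  have h := Submodule.mul_mem_mul hf hg
  rw [weightLE, weightLE, ← restrictSupport_add] at h
  refine restrictSupport_mono R ?_ h
  rintro _ ⟨d, hd, e, he, rfl⟩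
  simpa using add_le_add hd he

theorem pderiv_mem_weightLE {f : MvPolynomial σ R} (i : σ) (hf : f ∈ weightLE R w n) :
    pderiv i f ∈ weightLE R w (n - w i) := by
  rw [mem_weightLE] at hf ⊢
  intro d hd
  rw [coeff_pderiv] at hd
  have h := hf _ (left_ne_zero_of_mul hd)
  rw [map_add, Finsupp.weight_single, one_smul] at h
  exact le_sub_iff_add_le.mpr h

theorem mem_weightLE_of_isWeightedHomogeneous {f : MvPolynomial σ R}
    (hf : f.IsWeightedHomogeneous w n) : f ∈ weightLE R w n :=
  mem_weightLE.mpr fun _ hd => (hf hd).le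

theorem weightLE_le_of_monomial_mem {p : Submodule R (MvPolynomial σ R)}
    (h : ∀ d, Finsupp.weight w d ≤ n → monomial d 1 ∈ p) : weightLE R w n ≤ p := by
  rw [weightLE, restrictSupport_eq_span, Submodule.span_le]
  rintro _ ⟨d, hd, rfl⟩
  exact h d hd

theorem eq_zero_of_isWeightedHomogeneous_of_mem_weightLE {f : MvPolynomial σ R}
    (hf : f.IsWeightedHomogeneous w n) (hf' : f ∈ weightLE R w m) (h : m < n) : f = 0 := by
  ext d
  by_contra hd
  have := hf hd
  have := mem_weightLE.mp hf' d hd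
  omega

theorem sub_weightedHomogeneousComponent_mem_weightLE {f : MvPolynomial σ R}
    (hf : f ∈ weightLE R w n) :
    f - weightedHomogeneousComponent w n f ∈ weightLE R w (n - 1) := by
  rw [mem_weightLE] at hf ⊢
  intro d hd
  rw [coeff_sub, coeff_weightedHomogeneousComponent] at hd
  split_ifs at hd with h
  · simp at hd
  · have := hf d (by simpa using hd)
    omega

end weights

section poisson

open MvPolynomial

variable {R : Type u} [CommRing R] {w : Fin 2 → ℤ} {m n : ℤ} {f g : MvPolynomial (Fin 2) R}

/-- The Poisson bracket `{f, -}` on `R[X₀, X₁]`, with the sign convention `{X₀, X₁} = 1`. -/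
noncomputable def poisson (f : MvPolynomial (Fin 2) R) :
    Derivation R (MvPolynomial (Fin 2) R) (MvPolynomial (Fin 2) R) :=
  pderiv 0 f • pderiv 1 - pderiv 1 f • pderiv 0

theorem poisson_apply (f g : MvPolynomial (Fin 2) R) :
    poisson f g = pderiv 0 f * pderiv 1 g - pderiv 1 f * pderiv 0 g := rfl

theorem poisson_mem_weightLE (hf : f ∈ weightLE R w m) (hg : g ∈ weightLE R w n) :
    poisson f g ∈ weightLE R w (m + n - (w 0 + w 1)) := by
  refine sub_mem (weightLE_mono ?_ (mul_mem_weightLE (pderiv_mem_weightLE 0 hf)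
    (pderiv_mem_weightLE 1 hg))) (weightLE_mono ?_ (mul_mem_weightLE (pderiv_mem_weightLE 1 hf)
    (pderiv_mem_weightLE 0 hg)))
  all_goals omega

theorem isWeightedHomogeneous_poisson (hf : f.IsWeightedHomogeneous w m)
    (hg : g.IsWeightedHomogeneous w n) :
    (poisson f g).IsWeightedHomogeneous w (m + n - (w 0 + w 1)) := by
  have h (i j : Fin 2) (hij : w i + w j = w 0 + w 1) :
      (pderiv i f * pderiv j g).IsWeightedHomogeneous w (m + n - (w 0 + w 1)) := by
    rw [← hij, add_sub_add_comm]
    exact (hf.pderiv (sub_add_cancel _ _)).mul (hg.pderiv (sub_add_cancel _ _))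
  exact (h 0 1 rfl).sub (h 1 0 (add_comm _ _))

end poisson

section locallyNilpotent

variable {R : Type u} [CommRing R] {M : Type v} [AddCommGroup M] [Module R M] {T : Module.End R M}

/-- Every vector is killed by a power of the endomorphism. -/
def IsLocallyNilpotent (T : Module.End R M) : Prop := ∀ v, ∃ n : ℕ, (T ^ n) v = 0

theorem isLocallyNilpotent_iff_maxGenEigenspace :
    IsLocallyNilpotent T ↔ T.maxGenEigenspace 0 = ⊤ := by
  simp [IsLocallyNilpotent, Submodule.eq_top_iff', Module.End.mem_maxGenEigenspace]

theorem isLocallyNilpotent_of_span {s : Set M} (hs : Submodule.span R s = ⊤)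
    (h : ∀ v ∈ s, ∃ n : ℕ, (T ^ n) v = 0) : IsLocallyNilpotent T := by
  rw [isLocallyNilpotent_iff_maxGenEigenspace, ← top_le_iff, ← hs, Submodule.span_le]
  intro v hv
  simpa [Module.End.mem_maxGenEigenspace] using h v hv

end locallyNilpotent

namespace Weyl1

section principalSymbol

open MvPolynomial

variable {k : Type u} [Field k] {w : Fin 2 → ℤ} {m n : ℤ} {f g : MvPolynomial (Fin 2) k}
  {a b : Weyl1 k}

theorem act_y_pow_sub_mem_weightLE (hw : 0 ≤ w 0 + w 1) (hg : g ∈ weightLE k w n) (j : ℕ) :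
    act k (y k ^ j) g - X 1 ^ j * g + pderiv 1 (X 1 ^ j) * pderiv 0 g ∈
      weightLE k w (j * w 1 + n - 2 * (w 0 + w 1)) := by
  induction j with
  | zero => simp
  | succ j ih =>
    set e := act k (y k ^ j) g - X 1 ^ j * g + pderiv 1 (X 1 ^ j) * pderiv 0 g with he
    have recursion : act k (y k ^ (j + 1)) g - X 1 ^ (j + 1) * g +
        pderiv 1 (X 1 ^ (j + 1)) * pderiv 0 g =
        X 1 * e - pderiv 0 e + pderiv 1 (X 1 ^ j) * pderiv 0 (pderiv 0 g) := by
      rw [he, pow_succ' (y k), map_mul, Module.End.mul_apply, act_y, pow_succ' (X 1)]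
      simp only [pderiv_mul, pderiv_pow, pderiv_X_self, map_sub, map_add,
        pderiv_X_of_ne (show (1 : Fin 2) ≠ 0 by decide), pderiv_one, Derivation.map_natCast]
      ring
    have hX : X 1 ∈ weightLE k w (w 1) :=
      mem_weightLE_of_isWeightedHomogeneous (isWeightedHomogeneous_X k w 1)
    have hXj : (X 1 ^ j : MvPolynomial (Fin 2) k) ∈ weightLE k w (j • w 1) :=
      mem_weightLE_of_isWeightedHomogeneous ((isWeightedHomogeneous_X k w 1).pow j)
    rw [recursion]
    refine add_mem (sub_mem (weightLE_mono ?_ (mul_mem_weightLE hX ih))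
      (weightLE_mono ?_ (pderiv_mem_weightLE 0 ih)))
      (weightLE_mono ?_ (mul_mem_weightLE (pderiv_mem_weightLE 1 hXj)
        (pderiv_mem_weightLE 0 (pderiv_mem_weightLE 0 hg))))
    all_goals simp only [Nat.cast_succ, nsmul_eq_mul, add_mul, one_mul]; omega

-- The first terms of the expansion `act k a g = ∑ r, (-1)ʳ / r! * ∂₁ʳ (symbol k a) * ∂₀ʳ g`.
theorem act_sub_mem_weightLE (hw : 0 ≤ w 0 + w 1) (ha : symbol k a ∈ weightLE k w m)
    (hg : g ∈ weightLE k w n) :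
    act k a g - symbol k a * g + pderiv 1 (symbol k a) * pderiv 0 g ∈
      weightLE k w (m + n - 2 * (w 0 + w 1)) := by
  let error : MvPolynomial (Fin 2) k →ₗ[k] MvPolynomial (Fin 2) k :=
    (act k).toLinearMap.flip g ∘ₗ (symbol k).symm.toLinearMap - LinearMap.mulRight k g +
      LinearMap.mulRight k (pderiv 0 g) ∘ₗ (pderiv 1).toLinearMap
  have error_apply (f) : error f = act k ((symbol k).symm f) g - f * g +
      pderiv 1 f * pderiv 0 g := rfl
  suffices weightLE k w m ≤ (weightLE k w (m + n - 2 * (w 0 + w 1))).comap error by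
    simpa [error_apply] using this ha
  refine weightLE_le_of_monomial_mem fun d hd => ?_
  have hX : (X 0 ^ d 0 : MvPolynomial (Fin 2) k) ∈ weightLE k w (d 0 • w 0) :=
    mem_weightLE_of_isWeightedHomogeneous ((isWeightedHomogeneous_X k w 0).pow (d 0))
  rw [Finsupp.weight_eq_sum, Fin.sum_univ_two] at hd
  have factor : error (monomial d 1) = X 0 ^ d 0 * (act k (y k ^ d 1) g - X 1 ^ d 1 * g +
      pderiv 1 (X 1 ^ d 1) * pderiv 0 g) := by
    rw [error_apply, symbol_symm_monomial, one_smul, map_mul, Module.End.mul_apply, act_x_pow,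
      monomial_eq, Finsupp.prod_fintype _ _ (by simp), Fin.prod_univ_two, C_1, one_mul,
      Derivation.leibniz, Derivation.leibniz_pow (pderiv 1) (X 0),
      pderiv_X_of_ne (show (0 : Fin 2) ≠ 1 by decide)]
    simp only [smul_eq_mul, smul_zero, add_zero, mul_zero]
    ring
  rw [Submodule.mem_comap, factor]
  refine weightLE_mono ?_ (mul_mem_weightLE hX (act_y_pow_sub_mem_weightLE hw hg (d 1)))
  rw [nsmul_eq_mul, nsmul_eq_mul] at *
  linarith

variable (w n f a) in
/-- The polynomial `f` is the leading form of weight `n` of the symbol of `a`. It may vanish, in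
which case the symbol of `a` only has monomials of weight less than `n`. -/
structure IsPrincipalSymbol : Prop where
  isWeightedHomogeneous : f.IsWeightedHomogeneous w n
  symbol_sub_mem : symbol k a - f ∈ weightLE k w (n - 1)

namespace IsPrincipalSymbol

theorem symbol_mem (h : IsPrincipalSymbol w n f a) : symbol k a ∈ weightLE k w n := by
  have hf := mem_weightLE_of_isWeightedHomogeneous h.isWeightedHomogeneous
  simpa using add_mem (weightLE_mono (sub_one_lt n).le h.symbol_sub_mem) hf

theorem eq_zero (h : IsPrincipalSymbol w n f (0 : Weyl1 k)) : f = 0 := by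
  have h' := h.symbol_sub_mem
  rw [map_zero, zero_sub, neg_mem_iff] at h'
  exact eq_zero_of_isWeightedHomogeneous_of_mem_weightLE h.isWeightedHomogeneous h'
    (sub_one_lt n)

theorem weightedHomogeneousComponent (ha : symbol k a ∈ weightLE k w n) :
    IsPrincipalSymbol w n (MvPolynomial.weightedHomogeneousComponent w n (symbol k a)) a :=
  ⟨weightedHomogeneousComponent_isWeightedHomogeneous ..,
    sub_weightedHomogeneousComponent_mem_weightLE ha⟩

theorem of_symbol_eq (hf : f.IsWeightedHomogeneous w n) (ha : symbol k a = f) :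
    IsPrincipalSymbol w n f a :=
  ⟨hf, by simp [ha]⟩

theorem mul (hw : 0 < w 0 + w 1) (ha : IsPrincipalSymbol w m f a)
    (hb : IsPrincipalSymbol w n g b) : IsPrincipalSymbol w (m + n) (f * g) (a * b) where
  isWeightedHomogeneous := ha.isWeightedHomogeneous.mul hb.isWeightedHomogeneous
  symbol_sub_mem := by
    have expansion := act_sub_mem_weightLE hw.le ha.symbol_mem hb.symbol_mem
    have correction := mul_mem_weightLE (pderiv_mem_weightLE 1 ha.symbol_mem)
      (pderiv_mem_weightLE 0 hb.symbol_mem)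
    have left := mul_mem_weightLE ha.symbol_sub_mem hb.symbol_mem
    have right := mul_mem_weightLE
      (mem_weightLE_of_isWeightedHomogeneous ha.isWeightedHomogeneous) hb.symbol_sub_mem
    convert add_mem (sub_mem (weightLE_mono ?_ expansion) (weightLE_mono ?_ correction))
      (add_mem (weightLE_mono ?_ left) (weightLE_mono ?_ right)) using 1
    · rw [symbol_mul]
      ring
    all_goals omega

theorem pow (hw : 0 < w 0 + w 1) (ha : IsPrincipalSymbol w m f a) (n : ℕ) :
    IsPrincipalSymbol w (n • m) (f ^ n) (a ^ n) := by
  induction n with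
  | zero => simpa using of_symbol_eq (isWeightedHomogeneous_one k w) (symbol_algebraMap 1)
  | succ n ih => simpa only [pow_succ, succ_nsmul] using ih.mul hw ha

end IsPrincipalSymbol

/-- The inner derivation `b ↦ a * b - b * a`. -/
noncomputable def ad (a : Weyl1 k) : Module.End k (Weyl1 k) :=
  LinearMap.mulLeft k a - LinearMap.mulRight k a

theorem ad_apply (a b : Weyl1 k) : ad a b = a * b - b * a := rfl

theorem IsPrincipalSymbol.ad (hw : 0 < w 0 + w 1) (ha : IsPrincipalSymbol w m f a)
    (hb : IsPrincipalSymbol w n g b) :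
    IsPrincipalSymbol w (m + n - (w 0 + w 1)) (poisson f g) (ad a b) where
  isWeightedHomogeneous :=
    isWeightedHomogeneous_poisson ha.isWeightedHomogeneous hb.isWeightedHomogeneous
  symbol_sub_mem := by
    have expansion_mul := act_sub_mem_weightLE hw.le ha.symbol_mem hb.symbol_mem
    have expansion_mul' := act_sub_mem_weightLE hw.le hb.symbol_mem ha.symbol_mem
    have left := poisson_mem_weightLE ha.symbol_sub_mem hb.symbol_mem
    have right := poisson_mem_weightLE
      (mem_weightLE_of_isWeightedHomogeneous ha.isWeightedHomogeneous) hb.symbol_sub_mem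
    convert add_mem (sub_mem (weightLE_mono ?_ expansion_mul) (weightLE_mono ?_ expansion_mul'))
      (add_mem (weightLE_mono ?_ left) (weightLE_mono ?_ right)) using 1
    · simp only [ad_apply, map_sub, symbol_mul, poisson_apply]
      ring
    all_goals omega

theorem IsPrincipalSymbol.ad_pow (hw : 0 < w 0 + w 1) (ha : IsPrincipalSymbol w m f a)
    (hb : IsPrincipalSymbol w n g b) (r : ℕ) :
    IsPrincipalSymbol w (n + r • (m - (w 0 + w 1))) (((poisson f).toLinearMap ^ r) g)
      ((Weyl1.ad a ^ r) b) := by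
  induction r with
  | zero => simpa using hb
  | succ r ih =>
    rw [pow_succ', pow_succ', Module.End.mul_apply, Module.End.mul_apply]
    convert ha.ad hw ih using 1
    · rw [succ_nsmul]
      ring
    · rfl

theorem IsPrincipalSymbol.isLocallyNilpotent_poisson (hw : 0 < w 0 + w 1)
    (ha : IsPrincipalSymbol w m f a) (h : IsLocallyNilpotent (Weyl1.ad a)) :
    IsLocallyNilpotent (poisson f).toLinearMap := by
  refine isLocallyNilpotent_of_span (basisMonomials (Fin 2) k).span_eq ?_
  rintro _ ⟨d, rfl⟩
  obtain ⟨r, hr⟩ := h ((symbol k).symm (monomial d 1))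
  have hd := of_symbol_eq (isWeightedHomogeneous_monomial w d (1 : k) rfl)
    ((symbol k).apply_symm_apply _)
  exact ⟨r, (hr ▸ ha.ad_pow hw hd r).eq_zero⟩

theorem symbol_map_sub_aeval_mem_weightLE (hw : 0 < w 0 + w 1) {τ : Weyl1 k →ₐ[k] Weyl1 k}
    {t : Fin 2 → MvPolynomial (Fin 2) k} (hx : IsPrincipalSymbol w (w 0) (t 0) (τ (x k)))
    (hy : IsPrincipalSymbol w (w 1) (t 1) (τ (y k))) (ha : symbol k a ∈ weightLE k w n) :
    symbol k (τ a) - aeval t (symbol k a) ∈ weightLE k w (n - 1) := by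
  let error : MvPolynomial (Fin 2) k →ₗ[k] MvPolynomial (Fin 2) k :=
    (symbol k).toLinearMap ∘ₗ τ.toLinearMap ∘ₗ (symbol k).symm.toLinearMap -
      (aeval t).toLinearMap
  have error_apply (f) : error f = symbol k (τ ((symbol k).symm f)) - aeval t f := rfl
  suffices weightLE k w n ≤ (weightLE k w (n - 1)).comap error by
    simpa [error_apply] using this ha
  refine weightLE_le_of_monomial_mem fun d hd => ?_
  have h := ((hx.pow hw (d 0)).mul hw (hy.pow hw (d 1))).symbol_sub_mem
  rw [Finsupp.weight_eq_sum, Fin.sum_univ_two] at hd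
  rw [Submodule.mem_comap, error_apply, symbol_symm_monomial, one_smul, map_mul, map_pow τ,
    map_pow τ, aeval_monomial, map_one (algebraMap k _), one_mul,
    Finsupp.prod_fintype _ _ (by simp), Fin.prod_univ_two]
  exact weightLE_mono (sub_le_sub_right hd 1) h

end principalSymbol

end Weyl1

section exp

open Polynomial

variable {k : Type u} [Field k] {R : Type v} [CommRing R] [Algebra k R] {D : Derivation k R R}

namespace IsLocallyNilpotent

theorem finite_pow_ne_zero (hD : IsLocallyNilpotent D.toLinearMap) (g : R) :
    {n : ℕ | (D.toLinearMap ^ n) g ≠ 0}.Finite := by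
  obtain ⟨N, hN⟩ := hD g
  refine (Set.finite_Iio N).subset fun n hn => ?_
  by_contra h
  exact hn (Module.End.pow_map_zero_of_le (not_lt.mp h) hN)

/-- The linear map `g ↦ ∑ n, Dⁿ g / n! * Tⁿ` which underlies the exponential of `T * D`. -/
noncomputable def expLinear (hD : IsLocallyNilpotent D.toLinearMap) : R →ₗ[k] R[X] where
  toFun g := ⟨.ofCoeff <| .ofSupportFinite (fun n => (n.factorial : k)⁻¹ • (D.toLinearMap ^ n) g)
    ((hD.finite_pow_ne_zero g).subset fun _ h h' => h (by simp [h']))⟩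
  map_add' g h := by
    ext n
    simp [Finsupp.ofSupportFinite_coe]
  map_smul' r g := by
    ext n
    simp [Finsupp.ofSupportFinite_coe, smul_comm r]

variable (hD : IsLocallyNilpotent D.toLinearMap)

theorem coeff_expLinear (g : R) (n : ℕ) :
    (hD.expLinear g).coeff n = (n.factorial : k)⁻¹ • (D.toLinearMap ^ n) g :=
  rfl

theorem coeff_zero_expLinear (g : R) : (hD.expLinear g).coeff 0 = g := by
  simp [coeff_expLinear]

theorem expLinear_one : hD.expLinear 1 = 1 := by
  ext n
  cases n with
  | zero => simp [coeff_zero_expLinear]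
  | succ n =>
    rw [coeff_expLinear, pow_succ, Module.End.mul_apply, Derivation.coeFn_coe, D.map_one_eq_zero,
      map_zero, smul_zero, coeff_one, if_neg n.succ_ne_zero]

variable [CharZero k]

theorem derivative_expLinear (g : R) : derivative (hD.expLinear g) = hD.expLinear (D g) := by
  ext n
  have hn : (n + 1 : k) ≠ 0 := n.cast_add_one_ne_zero
  rw [coeff_derivative, coeff_expLinear, coeff_expLinear, pow_succ, Module.End.mul_apply,
    mul_comm, ← Nat.cast_succ, ← map_natCast (algebraMap k R), ← Algebra.smul_def, smul_smul,
    Nat.factorial_succ, Nat.cast_mul, mul_inv, Nat.cast_succ, mul_inv_cancel_left₀ hn]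
  rfl

-- Both sides satisfy the Leibniz rule for the derivative, and agree at `T = 0`.
theorem expLinear_mul (g h : R) : hD.expLinear (g * h) = hD.expLinear g * hD.expLinear h := by
  ext n
  induction n generalizing g h with
  | zero => simp only [mul_coeff_zero, coeff_zero_expLinear]
  | succ n ih =>
    have hn : IsUnit (n + 1 : R) := by
      simpa using (isUnit_iff_ne_zero.mpr (n.cast_add_one_ne_zero (R := k))).map (algebraMap k R)
    rw [← hn.mul_left_inj, ← coeff_derivative, ← coeff_derivative, derivative_expLinear,
      derivative_mul, derivative_expLinear, derivative_expLinear, D.leibniz, map_add, coeff_add,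
      smul_eq_mul, smul_eq_mul, ih, ih, coeff_add, mul_comm (hD.expLinear h), add_comm]

/-- The exponential `g ↦ ∑ n, Dⁿ g / n! * Tⁿ` of `T * D`, where `D` is a locally nilpotent
derivation. It serves to measure the elements of `R` by the degree of their exponential. -/
noncomputable def exp : R →ₐ[k] R[X] :=
  .ofLinearMap hD.expLinear hD.expLinear_one hD.expLinear_mul

theorem coeff_zero_exp (g : R) : (hD.exp g).coeff 0 = g := hD.coeff_zero_expLinear g

theorem derivative_exp (g : R) : derivative (hD.exp g) = hD.exp (D g) :=
  hD.derivative_expLinear g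

theorem exp_injective : Function.Injective hD.exp := fun g h hgh => by
  rw [← hD.coeff_zero_exp g, hgh, hD.coeff_zero_exp]

theorem natDegree_exp_lt {g : R} (hg : D g ≠ 0) :
    (hD.exp (D g)).natDegree < (hD.exp g).natDegree := by
  rw [← derivative_exp]
  refine natDegree_derivative_lt fun h => hg ?_
  rw [← hD.coeff_zero_exp (D g), ← derivative_exp, eq_C_of_natDegree_eq_zero h, derivative_C,
    coeff_zero]

variable [IsDomain R]

theorem natDegree_exp_mul {g h : R} (hg : g ≠ 0) (hh : h ≠ 0) :
    (hD.exp (g * h)).natDegree = (hD.exp g).natDegree + (hD.exp h).natDegree := by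
  rw [map_mul, natDegree_mul] <;> rwa [Ne, map_eq_zero_iff _ hD.exp_injective]

theorem natDegree_exp_eq_zero {g : R} (hg : D g = 0) : (hD.exp g).natDegree = 0 := by
  have := charZero_of_injective_algebraMap (algebraMap k R).injective
  rw [← derivative_eq_zero, derivative_exp, hg, map_zero]

end IsLocallyNilpotent

end exp

section Fin2

variable {M : Type v} [AddCommMonoid M]

theorem eq_or_eq_rev (i l : Fin 2) : l = i ∨ l = i.rev := by decide +revert

theorem rev_ne_self (i : Fin 2) : i.rev ≠ i := by decide +revert

theorem sum_eq_add_rev (i : Fin 2) (f : Fin 2 → M) : ∑ l, f l = f i + f i.rev := by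
  fin_cases i
  exacts [Fin.sum_univ_two f, (Fin.sum_univ_two f).trans (add_comm _ _)]

theorem weight_eq_add_rev (i : Fin 2) (w : Fin 2 → M) (d : Fin 2 →₀ ℕ) :
    Finsupp.weight w d = d i • w i + d i.rev • w i.rev := by
  rw [Finsupp.weight_eq_sum, sum_eq_add_rev i]

theorem eq_single_of_rev_eq_zero {i : Fin 2} {d : Fin 2 →₀ ℕ} (h : d i.rev = 0) :
    d = Finsupp.single i (d i) := by
  ext l
  obtain rfl | rfl := eq_or_eq_rev i l <;> simp [h, rev_ne_self]

theorem weight_update_one (i : Fin 2) (e : ℕ) (d : Fin 2 →₀ ℕ) :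
    Finsupp.weight (Function.update 1 i e : Fin 2 → ℕ) d = d i * e + d i.rev := by
  simp [weight_eq_add_rev i, rev_ne_self]

end Fin2

section weightedSubstitution

open MvPolynomial

variable {σ : Type v} {R : Type u} [CommRing R]

theorem eval_pow_mul_of_isWeightedHomogeneous {w : σ → ℕ} {n : ℕ} {f : MvPolynomial σ R}
    (hf : f.IsWeightedHomogeneous w n) (c : R) (z : σ → R) :
    eval (fun l => c ^ w l * z l) f = c ^ n * eval z f := by
  rw [eval_eq, eval_eq, Finset.mul_sum]
  refine Finset.sum_congr rfl fun d hd => ?_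
  rw [← hf (mem_support_iff.mp hd), Finsupp.weight_apply, Finsupp.sum, ← Finset.prod_pow_eq_pow_sum,
    mul_left_comm, ← Finset.prod_mul_distrib]
  simp only [mul_pow, ← pow_mul, smul_eq_mul, mul_comm]

variable {S : Type w} [CommRing S] [Algebra R S] {u : σ → Polynomial S} {D : σ → ℕ}

theorem natDegree_prod_le_and_coeff_prod (hu : ∀ l, (u l).natDegree ≤ D l) (d : σ →₀ ℕ) :
    (d.prod fun l e => u l ^ e).natDegree ≤ Finsupp.weight D d ∧
      (d.prod fun l e => u l ^ e).coeff (Finsupp.weight D d) =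
        d.prod fun l e => (u l).coeff (D l) ^ e := by
  induction d using Finsupp.induction_linear with
  | zero => simp
  | add d d' h h' =>
    rw [Finsupp.prod_add_index' (by simp) (by simp [pow_add]),
      Finsupp.prod_add_index' (by simp) (by simp [pow_add]), map_add,
      Polynomial.coeff_mul_add_eq_of_natDegree_le h.1 h'.1, h.2, h'.2]
    exact ⟨Polynomial.natDegree_mul_le_of_le h.1 h'.1, rfl⟩
  | single l e =>
    rw [Finsupp.prod_single_index (by simp), Finsupp.prod_single_index (by simp),
      Finsupp.weight_single, smul_eq_mul]
    exact ⟨Polynomial.natDegree_pow_le_of_le e (hu l), Polynomial.coeff_pow_of_natDegree_le (hu l)⟩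

theorem coeff_aeval_of_natDegree_le (hu : ∀ l, (u l).natDegree ≤ D l) {f : MvPolynomial σ R} {n : ℕ}
    (hf : weightedTotalDegree D f ≤ n) : (aeval u f).coeff n =
      aeval (fun l => (u l).coeff (D l)) (weightedHomogeneousComponent D n f) := by
  classical
  rw [weightedHomogeneousComponent_apply, map_sum, aeval_def, eval₂_eq, Polynomial.finsetSum_coeff,
    Finset.sum_filter]
  refine Finset.sum_congr rfl fun d hd => ?_
  obtain ⟨natDegree_le, coeff_eq⟩ := natDegree_prod_le_and_coeff_prod hu d
  rw [← Algebra.smul_def, Polynomial.coeff_smul]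
  split_ifs with h
  · subst h
    rw [aeval_monomial, ← Algebra.smul_def]
    exact congrArg _ coeff_eq
  · have weight_lt := ((le_weightedTotalDegree D hd).trans hf).lt_of_ne h
    have := Polynomial.coeff_eq_zero_of_natDegree_lt (natDegree_le.trans_lt weight_lt)
    exact (congrArg _ this).trans (smul_zero _)

end weightedSubstitution

section locallyNilpotentPoisson

open MvPolynomial

variable {k : Type u} [Field k] {f : MvPolynomial (Fin 2) k}

theorem poisson_self : poisson f f = 0 := by
  rw [poisson_apply, mul_comm, sub_self]

theorem poisson_X (i : Fin 2) :
    poisson f (X i) = pderiv i.rev f ∨ poisson f (X i) = -pderiv i.rev f := by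
  rw [poisson_apply]
  fin_cases i <;> simp

theorem weightedHomogeneousComponent_eq_monomial {i : Fin 2} {a e : ℕ} (he : 0 < e)
    (hfw : f.IsWeightedHomogeneous (Function.update 1 i e) (a * e)) {D : Fin 2 → ℕ}
    (hD : e * D i.rev < D i) : weightedTotalDegree D f ≤ a * D i ∧
      weightedHomogeneousComponent D (a * D i) f =
        monomial (Finsupp.single i a) (coeff (Finsupp.single i a) f) := by
  have weight_le {d} (hd : coeff d f ≠ 0) :
      Finsupp.weight D d ≤ a * D i ∧ (Finsupp.weight D d = a * D i → d = Finsupp.single i a) := by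
    have weight_eq := hfw hd
    rw [weight_update_one] at weight_eq
    obtain ⟨q, rfl⟩ : ∃ q, a = d i + q := Nat.exists_eq_add_of_le (by nlinarith)
    rw [weight_eq_add_rev i, smul_eq_mul, smul_eq_mul, show d i.rev = q * e by linarith]
    refine ⟨by nlinarith, fun h => ?_⟩
    obtain rfl : q = 0 := by nlinarith
    exact eq_single_of_rev_eq_zero (by linarith)
  refine ⟨Finset.sup_le fun d hd => (weight_le (mem_support_iff.mp hd)).1, ?_⟩
  ext d
  rw [coeff_weightedHomogeneousComponent, coeff_monomial]
  by_cases hd : Finsupp.single i a = d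
  · rw [← hd, Finsupp.weight_single, smul_eq_mul, if_pos rfl, if_pos rfl]
  · rw [if_neg hd, ite_eq_right_iff]
    intro h
    by_contra h'
    exact hd ((weight_le h').2 h).symm

variable [CharZero k] (hf : IsLocallyNilpotent (poisson f).toLinearMap)

theorem natDegree_exp_pderiv_rev_lt {i : Fin 2} (hi : pderiv i.rev f ≠ 0) :
    (hf.exp (pderiv i.rev f)).natDegree < (hf.exp (X i)).natDegree := by
  have h := poisson_X (f := f) i
  convert hf.natDegree_exp_lt (g := X i) (by aesop) using 1
  rcases h with h | h <;> simp [h]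

include hf in
theorem pderiv_rev_eq_zero_of_X_dvd {i : Fin 2} (h : X i ∣ f) : pderiv i.rev f = 0 := by
  by_contra hi
  obtain ⟨g, hg⟩ := h
  have hg0 : g ≠ 0 := by
    rintro rfl
    simp [hg] at hi
  have natDegree_X_add := hf.natDegree_exp_mul (X_ne_zero i) hg0
  rw [← hg, hf.natDegree_exp_eq_zero poisson_self] at natDegree_X_add
  have := natDegree_exp_pderiv_rev_lt hf hi
  omega

theorem natDegree_exp_X_rev_lt {i : Fin 2} (hi : pderiv i.rev f ≠ 0)
    (h : X i.rev ∣ pderiv i.rev f) :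
    (hf.exp (X i.rev)).natDegree < (hf.exp (X i)).natDegree := by
  refine lt_of_le_of_lt ?_ (natDegree_exp_pderiv_rev_lt hf hi)
  obtain ⟨g, hg⟩ := h
  rw [hg, hf.natDegree_exp_mul (X_ne_zero _) (right_ne_zero_of_mul (hg ▸ hi))]
  exact Nat.le_add_right _ _

include hf in
theorem exists_not_X_dvd_pderiv (h : ∀ i, pderiv i f ≠ 0) : ∃ i, ¬ X i ∣ pderiv i f := by
  by_contra! hdvd
  have h0 := natDegree_exp_X_rev_lt hf (i := 0) (h _) (hdvd _)
  have h1 := natDegree_exp_X_rev_lt hf (i := 1) (h _) (hdvd _)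
  exact lt_asymm h0 h1

theorem coeff_aeval_exp_X_eq_zero {n : ℕ} (hn : 0 < n) :
    (aeval (fun l => hf.exp (X l)) f).coeff n = 0 := by
  have h : aeval (fun l => hf.exp (X l)) f = hf.exp f :=
    (DFunLike.congr_fun (aeval_unique _) f).symm
  rw [h]
  exact Polynomial.coeff_eq_zero_of_natDegree_lt
    ((hf.natDegree_exp_eq_zero poisson_self).trans_lt hn)

-- Otherwise `X i ^ a` alone would contribute to the top degree part of `f(exp X₀, exp X₁)`, which
-- is the constant `exp f = f`.
theorem natDegree_exp_X_le {i : Fin 2} {a e : ℕ} (ha : 0 < a) (he : 0 < e)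
    (hfw : f.IsWeightedHomogeneous (Function.update 1 i e) (a * e))
    (hfa : coeff (Finsupp.single i a) f ≠ 0) :
    (hf.exp (X i)).natDegree ≤ e * (hf.exp (X i.rev)).natDegree := by
  by_contra! hlt
  obtain ⟨weightedTotalDegree_le, component⟩ := weightedHomogeneousComponent_eq_monomial he hfw
    (D := fun l => (hf.exp (X l)).natDegree) hlt
  have top := coeff_aeval_of_natDegree_le (fun l => le_rfl) weightedTotalDegree_le
  rw [coeff_aeval_exp_X_eq_zero hf (mul_pos ha (Nat.zero_lt_of_lt hlt)), component, aeval_monomial,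
    Finsupp.prod_single_index (by rw [pow_zero])] at top
  have leadingCoeff_ne_zero : (hf.exp (X i)).leadingCoeff ≠ 0 := by
    rw [Polynomial.leadingCoeff_ne_zero, Ne, map_eq_zero_iff _ hf.exp_injective]
    exact X_ne_zero i
  exact mul_ne_zero (by simpa using hfa) (pow_ne_zero a leadingCoeff_ne_zero) top.symm

include hf in
theorem exists_aeval_eq_zero {i : Fin 2} (hi : pderiv i f ≠ 0) {a e : ℕ} (ha : 0 < a)
    (he : 0 < e) (hfw : f.IsWeightedHomogeneous (Function.update 1 i e) (a * e))
    (hfa : coeff (Finsupp.single i a) f ≠ 0) :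
    ∃ v : Fin 2 → MvPolynomial (Fin 2) k, v i.rev ≠ 0 ∧ aeval v f = 0 := by
  set β := (hf.exp (X i.rev)).natDegree with hβ
  have hβ0 : 0 < β := by
    have := natDegree_exp_pderiv_rev_lt hf (i := i.rev) (by rwa [Fin.rev_rev])
    omega
  set D : Fin 2 → ℕ := Function.update (fun _ => β) i (e * β)
  have hDi : D i = e * β := Function.update_self ..
  have hDr : D i.rev = β := Function.update_of_ne (rev_ne_self i) ..
  have natDegree_le (l) : (hf.exp (X l)).natDegree ≤ D l := by
    obtain rfl | rfl := eq_or_eq_rev i l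
    exacts [(natDegree_exp_X_le hf ha he hfw hfa).trans_eq hDi.symm, hDr.ge]
  have hfD : f.IsWeightedHomogeneous D (a * e * β) := fun d hd => by
    rw [← hfw hd, weight_update_one, weight_eq_add_rev i, hDi, hDr, smul_eq_mul, smul_eq_mul]
    ring
  have top := coeff_aeval_of_natDegree_le natDegree_le
    (Finset.sup_le fun d hd => (hfD (mem_support_iff.mp hd)).le)
  rw [coeff_aeval_exp_X_eq_zero hf (by positivity),
    weightedHomogeneousComponent_eq_self hfD] at top
  refine ⟨_, ?_, top.symm⟩
  rw [hDr, hβ, Polynomial.coeff_natDegree, Polynomial.leadingCoeff_ne_zero, Ne,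
    map_eq_zero_iff _ hf.exp_injective]
  exact X_ne_zero _

include hf in
theorem exists_eval_eq_zero {i : Fin 2} (hi : pderiv i f ≠ 0) {a e : ℕ} (ha : 0 < a)
    (he : 0 < e) (hfw : f.IsWeightedHomogeneous (Function.update 1 i e) (a * e))
    (hfa : coeff (Finsupp.single i a) f ≠ 0) :
    ∃ r : k, eval (Function.update (Pi.single i.rev 1) i r) f = 0 := by
  obtain ⟨v, hv, hvf⟩ := exists_aeval_eq_zero hf hi ha he hfw hfa
  obtain ⟨z, hz⟩ : ∃ z, eval z (v i.rev) ≠ 0 := by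
    by_contra! h
    exact hv (MvPolynomial.funext fun z => by rw [h z, map_zero])
  set c := eval z (v i.rev)
  refine ⟨eval z (v i) / c ^ e, ?_⟩
  have scaling : (fun l => eval z (v l)) = fun l => c ^ (Function.update 1 i e : Fin 2 → ℕ) l *
      Function.update (Pi.single i.rev 1 : Fin 2 → k) i (eval z (v i) / c ^ e) l := by
    ext l
    obtain rfl | rfl := eq_or_eq_rev i l
    · simp [mul_div_cancel₀, hz]
    · simp [rev_ne_self, c]
  have h : eval z (aeval v f) = eval (fun l => eval z (v l)) f := by
    simp only [← coe_aeval_eq_eval, RingHom.coe_coe]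
    exact comp_aeval_apply ..
  rw [hvf, map_zero, scaling, eval_pow_mul_of_isWeightedHomogeneous hfw] at h
  exact (mul_eq_zero.mp h.symm).resolve_left (pow_ne_zero _ hz)

end locallyNilpotentPoisson

namespace IsLocallyNilpotent

variable {R : Type u} [CommRing R]

theorem of_semiconj {M : Type v} {N : Type w} [AddCommGroup M] [Module R M] [AddCommGroup N]
    [Module R N] {T : Module.End R M} {S : Module.End R N} (hS : IsLocallyNilpotent S)
    (e : M ≃ₗ[R] N) (h : Function.Semiconj e T S) : IsLocallyNilpotent T := fun v => by
  obtain ⟨n, hn⟩ := hS (e v)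
  refine ⟨n, e.map_eq_zero_iff.mp ?_⟩
  rwa [Module.End.pow_apply, h.iterate_right n, ← Module.End.pow_apply]

theorem pderiv {σ : Type v} (i : σ) :
    IsLocallyNilpotent (MvPolynomial.pderiv (R := R) i).toLinearMap := by
  refine isLocallyNilpotent_of_span (MvPolynomial.basisMonomials σ R).span_eq ?_
  rintro _ ⟨d, rfl⟩
  refine ⟨d i + 1, ?_⟩
  have key (n : ℕ) (d : σ →₀ ℕ) (r : R) (hd : d i < n) :
      ((MvPolynomial.pderiv i).toLinearMap ^ n) (MvPolynomial.monomial d r) = 0 := by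
    induction n generalizing d r with
    | zero => omega
    | succ n ih =>
      rw [pow_succ, Module.End.mul_apply, Derivation.coeFn_coe, MvPolynomial.pderiv_monomial]
      rcases eq_or_ne (d i) 0 with h | h
      · rw [h, Nat.cast_zero, mul_zero, map_zero, map_zero]
      · exact ih _ _ (by simp; omega)
  exact key _ d 1 (Nat.lt_succ_self _)

end IsLocallyNilpotent

theorem eq_zero_of_pderiv_eq_zero {σ : Type v} {R : Type u} [CommRing R] [IsDomain R] [CharZero R]
    {f : MvPolynomial σ R} {i : σ} (h : MvPolynomial.pderiv i f = 0) {d : σ →₀ ℕ}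
    (hd : MvPolynomial.coeff d f ≠ 0) : d i = 0 := by
  by_contra hi
  have coeff_eq := MvPolynomial.coeff_pderiv (i := i) f (d - Finsupp.single i 1)
  rw [h, MvPolynomial.coeff_zero,
    tsub_add_cancel_of_le (by simpa using Nat.one_le_iff_ne_zero.mpr hi)] at coeff_eq
  exact mul_ne_zero hd (Nat.cast_add_one_ne_zero _) coeff_eq.symm

namespace Weyl1

section rangeDescend

variable {k : Type u} [Field k]

/-- The automorphism `x ↦ y`, `y ↦ -x` of `A₁`. -/
noncomputable def fourier : Weyl1 k ≃ₐ[k] Weyl1 k :=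
  descend k ⟨F2.fourier, F2.fourier_mem_hamiltonianAut⟩

theorem fourier_mem_range_descend : fourier ∈ (descend k).range := ⟨_, rfl⟩

theorem fourier_x : fourier (x k) = y k := by
  rw [fourier, x, descend_mk, F2.fourier_x, y]

theorem fourier_y : fourier (y k) = -x k := by
  rw [fourier, y, descend_mk, F2.fourier_y, map_neg, x]

/-- The automorphism `x ↦ α x + β`, `y ↦ α⁻¹ y + q(x)` of `A₁`. -/
noncomputable def triangularAut (α : kˣ) (β : k) (q : Polynomial k) : Weyl1 k ≃ₐ[k] Weyl1 k :=
  descend k ⟨F2.triangularAut α β q, F2.triangularAut_mem_hamiltonianAut α β q⟩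

theorem triangularAut_mem_range_descend (α : kˣ) (β : k) (q : Polynomial k) :
    triangularAut α β q ∈ (descend k).range := ⟨_, rfl⟩

theorem triangularAut_x (α : kˣ) (β : k) (q : Polynomial k) :
    triangularAut α β q (x k) = (α : k) • x k + algebraMap k _ β := by
  rw [triangularAut, x, descend_mk, F2.triangularAut_x, map_add, map_smul, AlgHom.commutes]

theorem triangularAut_y (α : kˣ) (β : k) (q : Polynomial k) :
    triangularAut α β q (y k) = (↑α⁻¹ : k) • y k + Polynomial.aeval (x k) q := by
  rw [triangularAut, y, descend_mk, F2.triangularAut_y, map_add, map_smul,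
    ← Polynomial.aeval_algHom_apply, x]

open MvPolynomial

theorem symbol_aeval_x (p : Polynomial k) :
    symbol k (Polynomial.aeval (x k) p) = Polynomial.aeval (X 0) p := by
  have h : act k (x k) = Algebra.lmul k _ (X 0) := LinearMap.ext act_x
  rw [symbol_apply, ← Polynomial.aeval_algHom_apply, h, Polynomial.aeval_algHom_apply,
    Algebra.coe_lmul_eq_mul, LinearMap.mul_apply', mul_one]

theorem symbol_y_pow (n : ℕ) : symbol k (y k ^ n) = X 1 ^ n := by
  rw [symbol_apply, act_y_pow_one]

theorem exists_shear (i : Fin 2) (r : k) (e : ℕ) : ∃ ψ ∈ (descend k).range, ∀ l,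
    symbol k (ψ (![x k, y k] l)) = Function.update X i (X i + C r * X i.rev ^ e) l := by
  obtain rfl | rfl : i = 0 ∨ i = 1 := by omega
  · refine ⟨fourier * triangularAut 1 0 (.monomial e (-r)) * fourier⁻¹,
      mul_mem (mul_mem fourier_mem_range_descend (triangularAut_mem_range_descend ..))
        (inv_mem fourier_mem_range_descend), Fin.forall_fin_two.mpr ⟨?_, ?_⟩⟩
    · have h : fourier⁻¹ (x k) = -y k :=
        (fourier.symm_apply_eq).mpr (by rw [map_neg, fourier_y, neg_neg])
      simp [AlgEquiv.mul_apply, h, triangularAut_y, fourier_x, fourier_y, Polynomial.aeval_monomial,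
        ← Algebra.smul_def, symbol_x, symbol_y_pow, add_comm, smul_eq_C_mul]
    · have h : fourier⁻¹ (y k) = x k := (fourier.symm_apply_eq).mpr fourier_x.symm
      simp [AlgEquiv.mul_apply, h, triangularAut_x, fourier_x, symbol_y]
  · refine ⟨triangularAut 1 0 (.monomial e r), triangularAut_mem_range_descend ..,
      Fin.forall_fin_two.mpr ⟨?_, ?_⟩⟩
    · simp [triangularAut_x, symbol_x]
    · have h : symbol k (triangularAut 1 0 (.monomial e r) (y k)) = X 1 + C r * X 0 ^ e := by
        rw [triangularAut_y, map_add, symbol_aeval_x, inv_one, Units.val_one, one_smul, symbol_y,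
          Polynomial.aeval_monomial, algebraMap_eq]
      simpa using h

end rangeDescend

section centralizer

variable {k : Type u} [Field k]

open MvPolynomial

theorem symbol_ad_x (a : Weyl1 k) : symbol k (ad (x k) a) = pderiv 1 (symbol k a) := by
  rw [ad_apply, map_sub, symbol_x_mul, symbol_mul_x, sub_sub_cancel]

theorem isLocallyNilpotent_ad_x : IsLocallyNilpotent (ad (x k)) :=
  (IsLocallyNilpotent.pderiv 1).of_semiconj (symbol k) symbol_ad_x

theorem isLocallyNilpotent_ad_map_x (φ : Weyl1 k ≃ₐ[k] Weyl1 k) :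
    IsLocallyNilpotent (ad (φ (x k))) :=
  isLocallyNilpotent_ad_x.of_semiconj φ.symm.toLinearEquiv fun a => by simp [ad_apply]

theorem mem_adjoin_of_support {i : Fin 2} {a : Weyl1 k}
    (h : ∀ m ∈ (symbol k a).support, m i.rev = 0) : a ∈ Algebra.adjoin k {![x k, y k] i} := by
  rw [← (symbol k).symm_apply_apply a, (symbol k a).as_sum, map_sum]
  refine sum_mem fun m hm => ?_
  rw [symbol_symm_monomial]
  refine Subalgebra.smul_mem _ ?_ _
  have hm := h m hm
  have mem := pow_mem (Algebra.self_mem_adjoin_singleton k (![x k, y k] i)) (m i)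
  fin_cases i
  exacts [by simpa [show m 1 = 0 from hm] using mem, by simpa [show m 0 = 0 from hm] using mem]

theorem aeval_x_injective : Function.Injective (Polynomial.aeval (R := k) (x k)) := by
  intro p q hpq
  have h := congrArg (fun a => aeval (fun _ => (Polynomial.X : Polynomial k)) (symbol k a)) hpq
  simpa [symbol_aeval_x, ← Polynomial.aeval_algHom_apply] using h

variable [CharZero k]

theorem exists_eq_aeval_of_commute_x {a : Weyl1 k} (h : x k * a = a * x k) :
    ∃ q : Polynomial k, a = Polynomial.aeval (x k) q := by
  have pderiv_symbol : pderiv 1 (symbol k a) = 0 := by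
    rw [← symbol_ad_x, ad_apply, h, sub_self, map_zero]
  have mem := mem_adjoin_of_support (i := 0) fun m hm =>
    eq_zero_of_pderiv_eq_zero pderiv_symbol (mem_support_iff.mp hm)
  rw [Algebra.adjoin_singleton_eq_range_aeval] at mem
  obtain ⟨q, hq⟩ := mem
  exact ⟨q, hq.symm⟩

variable {φ : Weyl1 k ≃ₐ[k] Weyl1 k}

-- Both `φ x` and `φ⁻¹ x` are polynomials in `x`, and their composition has degree `1`.
theorem exists_map_x_eq (h : φ (x k) ∈ Algebra.adjoin k {x k}) :
    ∃ (α : kˣ) (β : k), φ (x k) = (α : k) • x k + algebraMap k _ β := by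
  rw [Algebra.adjoin_singleton_eq_range_aeval] at h
  obtain ⟨p, hp : Polynomial.aeval (x k) p = φ (x k)⟩ := h
  obtain ⟨q, hq⟩ : ∃ q : Polynomial k, φ.symm (x k) = Polynomial.aeval (x k) q := by
    refine exists_eq_aeval_of_commute_x (φ.injective ?_)
    rw [map_mul, map_mul, φ.apply_symm_apply, ← hp]
    simpa using congrArg (Polynomial.aeval (x k)) (mul_comm p Polynomial.X)
  have comp_eq : q.comp p = Polynomial.X := aeval_x_injective <| by
    rw [Polynomial.aeval_comp, hp, Polynomial.aeval_X, Polynomial.aeval_algHom_apply, ← hq,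
      φ.apply_symm_apply]
  have natDegree_p : p.natDegree = 1 := by
    have := congrArg Polynomial.natDegree comp_eq
    rw [Polynomial.natDegree_comp, Polynomial.natDegree_X] at this
    exact Nat.eq_one_of_mul_eq_one_left this
  obtain ⟨α, hα, β, rfl⟩ := Polynomial.natDegree_eq_one.mp natDegree_p
  exact ⟨Units.mk0 α hα, β, by simp [← hp, Algebra.smul_def]⟩

-- By the defining relation, `φ y - α⁻¹ y` commutes with `x`.
theorem exists_map_y_eq {α : kˣ} {β : k} (h : φ (x k) = (α : k) • x k + algebraMap k _ β) :
    ∃ q : Polynomial k, φ (y k) = (↑α⁻¹ : k) • y k + Polynomial.aeval (x k) q := by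
  have commutator : x k * φ (y k) = φ (y k) * x k + (↑α⁻¹ : k) • 1 := by
    have relation := congrArg φ (x_mul_y k)
    rw [map_mul, map_add, map_mul, map_one, h, add_mul, mul_add, Algebra.commutes,
      smul_mul_assoc, mul_smul_comm, add_right_comm] at relation
    simpa [smul_add, smul_smul] using congrArg ((↑α⁻¹ : k) • ·) (add_right_cancel relation)
  obtain ⟨q, hq⟩ := exists_eq_aeval_of_commute_x (a := φ (y k) - (↑α⁻¹ : k) • y k) <| by
    rw [mul_sub, sub_mul, commutator, mul_smul_comm, smul_mul_assoc, x_mul_y, smul_add]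
    abel
  exact ⟨q, by rw [← hq, add_sub_cancel]⟩

theorem mem_range_descend_of_map_x_mem_adjoin_x (h : φ (x k) ∈ Algebra.adjoin k {x k}) :
    φ ∈ (descend k).range := by
  obtain ⟨α, β, hx⟩ := exists_map_x_eq h
  obtain ⟨q, hy⟩ := exists_map_y_eq hx
  have : (φ : Weyl1 k →ₐ[k] Weyl1 k) = triangularAut α β q :=
    hom_ext (hx.trans (triangularAut_x α β q).symm) (hy.trans (triangularAut_y α β q).symm)
  rw [AlgEquiv.coe_toAlgHom_injective this]
  exact triangularAut_mem_range_descend α β q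

theorem mem_range_descend_of_map_x_mem_adjoin_y (h : φ (x k) ∈ Algebra.adjoin k {y k}) :
    φ ∈ (descend k).range := by
  have := fourier_mem_range_descend (k := k)
  refine (Subgroup.mul_mem_cancel_left _ this).mp (mem_range_descend_of_map_x_mem_adjoin_x ?_)
  rw [Algebra.adjoin_singleton_eq_range_aeval] at h
  obtain ⟨p, hp : Polynomial.aeval (y k) p = φ (x k)⟩ := h
  rw [AlgEquiv.mul_apply, ← hp, ← Polynomial.aeval_algHom_apply, fourier_y]
  refine Algebra.adjoin_le ?_ (Polynomial.aeval_mem_adjoin_singleton k _)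
  simp [Algebra.self_mem_adjoin_singleton]

end centralizer

end Weyl1

section leadingForm

open MvPolynomial

variable {σ : Type v} {R : Type u} [CommRing R]

theorem X_dvd_of_forall_coeff {f : MvPolynomial σ R} {i : σ}
    (h : ∀ d, coeff d f ≠ 0 → d i ≠ 0) : X i ∣ f := by
  rw [f.as_sum]
  exact Finset.dvd_sum fun d hd => X_dvd_monomial.mpr (.inr (h d (mem_support_iff.mp hd)))

theorem exists_coeff_ne_zero_apply_eq_degreeOf {f : MvPolynomial σ R} (hf : f ≠ 0) (i : σ) :
    ∃ d, coeff d f ≠ 0 ∧ d i = degreeOf i f := by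
  obtain ⟨d, hd, h⟩ := Finset.exists_mem_eq_sup f.support (support_nonempty.mpr hf) (· i)
  exact ⟨d, mem_support_iff.mp hd, by rw [degreeOf_eq_sup, h]⟩

theorem isWeightedHomogeneous_aeval {w : σ → ℤ} {n : ℤ} {f : MvPolynomial σ R}
    {t : σ → MvPolynomial σ R} (ht : ∀ l, (t l).IsWeightedHomogeneous w (w l))
    (hf : f.IsWeightedHomogeneous w n) : (aeval t f).IsWeightedHomogeneous w n := by
  rw [aeval_def, eval₂_eq]
  refine IsWeightedHomogeneous.sum _ _ _ fun d hd => ?_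
  rw [← hf (mem_support_iff.mp hd), Finsupp.weight_apply, ← zero_add (Finsupp.sum _ _)]
  exact (isWeightedHomogeneous_C w _).mul (IsWeightedHomogeneous.prod _ _ _ fun l _ => (ht l).pow _)

theorem aeval_mem_weightLE {w : σ → ℤ} {n : ℤ} {f : MvPolynomial σ R} {t : σ → MvPolynomial σ R}
    (ht : ∀ l, (t l).IsWeightedHomogeneous w (w l)) (hf : f ∈ weightLE R w n) :
    aeval t f ∈ weightLE R w n := by
  suffices weightLE R w n ≤ (weightLE R w n).comap (aeval t).toLinearMap from this hf
  refine weightLE_le_of_monomial_mem fun d hd => weightLE_mono hd ?_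
  exact mem_weightLE_of_isWeightedHomogeneous
    (isWeightedHomogeneous_aeval ht (isWeightedHomogeneous_monomial w d 1 rfl))

end leadingForm

section newtonPolygon

open MvPolynomial

variable {k : Type u} [Field k] {p q : MvPolynomial (Fin 2) k} {i : Fin 2}

variable (p) in
/-- The weights for which `X₀ ^ deg₀ p` and `X₁ ^ deg₁ p` have the same weight, so that the edge of
the Newton polygon which joins these two vertices has constant weight. -/
noncomputable def edgeWeight (l : Fin 2) : ℤ := degreeOf l.rev p

variable (p) in
/-- The weight of `X₀ ^ deg₀ p` and of `X₁ ^ deg₁ p` with respect to `edgeWeight p`. -/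
noncomputable def edgeDegree : ℤ := degreeOf 0 p * degreeOf 1 p

variable (p) in
/-- The part of `p` on the edge of the Newton polygon which joins `X₀ ^ deg₀ p` and
`X₁ ^ deg₁ p`. -/
noncomputable def edgeForm : MvPolynomial (Fin 2) k :=
  weightedHomogeneousComponent (edgeWeight p) (edgeDegree p) p

theorem edgeDegree_eq (i : Fin 2) : edgeDegree p = degreeOf i p * degreeOf i.rev p := by
  fin_cases i
  exacts [rfl, mul_comm _ _]

theorem weight_edgeWeight (i : Fin 2) (d : Fin 2 →₀ ℕ) :
    Finsupp.weight (edgeWeight p) d = d i * degreeOf i.rev p + d i.rev * degreeOf i p := by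
  simp [weight_eq_add_rev i, edgeWeight]

theorem weight_edgeWeight_single (i : Fin 2) :
    Finsupp.weight (edgeWeight p) (Finsupp.single i (degreeOf i p)) = edgeDegree p := by
  rw [weight_edgeWeight i, edgeDegree_eq i]
  simp [rev_ne_self]

theorem edgeWeight_zero_add_one_pos (h : ∀ l, 0 < degreeOf l p) :
    0 < edgeWeight p 0 + edgeWeight p 1 :=
  add_pos (Int.natCast_pos.mpr (h _)) (Int.natCast_pos.mpr (h _))

theorem coeff_edgeForm_single (i : Fin 2) :
    coeff (Finsupp.single i (degreeOf i p)) (edgeForm p) =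
      coeff (Finsupp.single i (degreeOf i p)) p := by
  rw [edgeForm, coeff_weightedHomogeneousComponent, if_pos (weight_edgeWeight_single i)]

theorem isWeightedHomogeneous_edgeForm :
    (edgeForm p).IsWeightedHomogeneous (edgeWeight p) (edgeDegree p) :=
  weightedHomogeneousComponent_isWeightedHomogeneous ..

theorem isWeightedHomogeneous_edgeForm_update {e : ℕ} (hi : 0 < degreeOf i p)
    (he : degreeOf i.rev p = degreeOf i p * e) :
    (edgeForm p).IsWeightedHomogeneous (Function.update 1 i e : Fin 2 → ℕ) (degreeOf i p * e) := by
  intro d hd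
  have h := isWeightedHomogeneous_edgeForm hd
  rw [weight_edgeWeight i, edgeDegree_eq i, he] at h
  rw [weight_update_one]
  refine Nat.eq_of_mul_eq_mul_left hi ?_
  zify
  push_cast at h
  linarith

theorem degreeOf_dvd_of_not_X_dvd_pderiv_edgeForm (h : ¬ X i ∣ pderiv i (edgeForm p)) :
    degreeOf i p ∣ degreeOf i.rev p := by
  contrapose! h
  refine X_dvd_of_forall_coeff fun d hd hdi => h ?_
  rw [coeff_pderiv] at hd
  have := isWeightedHomogeneous_edgeForm (left_ne_zero_of_mul hd)
  rw [weight_edgeWeight i, edgeDegree_eq i] at this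
  simp only [Finsupp.add_apply, Finsupp.single_eq_same, hdi, zero_add, Nat.cast_one, one_mul,
    Finsupp.single_eq_of_ne (rev_ne_self i), add_zero] at this
  norm_cast at this
  exact (Nat.dvd_add_left (dvd_mul_left _ _)).mp (this ▸ dvd_mul_right _ _)

theorem degreeOf_le_of_mem_weightLE (hi : 0 < degreeOf i.rev p)
    (hq : q ∈ weightLE k (edgeWeight p) (edgeDegree p)) : degreeOf i q ≤ degreeOf i p := by
  refine degreeOf_le_iff.mpr fun d hd => Nat.le_of_mul_le_mul_right ?_ hi
  have h := mem_weightLE.mp hq d (mem_support_iff.mp hd)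
  rw [weight_edgeWeight i, edgeDegree_eq i] at h
  norm_cast at h
  exact le_of_add_le_left h

theorem eval_single_one_of_isWeightedHomogeneous {w : Fin 2 → ℤ} (hw : w i ≠ 0) {n : ℤ}
    (hq : q.IsWeightedHomogeneous w n) {c : ℕ} (hc : Finsupp.weight w (Finsupp.single i c) = n) :
    eval (Pi.single i 1) q = coeff (Finsupp.single i c) q := by
  rw [eval_eq', Finset.sum_eq_single (Finsupp.single i c)]
  · rw [Finset.prod_eq_single i, Pi.single_eq_same, one_pow, mul_one]
    · exact fun l _ hl => by rw [Finsupp.single_eq_of_ne hl, pow_zero]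
    · simp
  · intro d hd hne
    have hrev : d i.rev ≠ 0 := fun h => hne <| by
      have weight_eq := (hq (mem_support_iff.mp hd)).trans hc.symm
      rw [eq_single_of_rev_eq_zero h, Finsupp.weight_single, Finsupp.weight_single] at weight_eq
      rw [eq_single_of_rev_eq_zero h, show d i = c by simpa [hw] using weight_eq]
    rw [Finset.prod_eq_zero (Finset.mem_univ i.rev), mul_zero]
    simp [rev_ne_self, hrev]
  · simp +contextual

theorem eval_single_aeval_update (r : k) (e : ℕ) (f : MvPolynomial (Fin 2) k) :
    eval (Pi.single i.rev 1) (aeval (Function.update X i (X i + C r * X i.rev ^ e)) f) =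
      eval (Function.update (Pi.single i.rev 1) i r) f := by
  simp only [← coe_aeval_eq_eval, RingHom.coe_coe]
  rw [comp_aeval_apply]
  congr 2
  ext l
  obtain rfl | rfl := eq_or_eq_rev i l <;> simp [rev_ne_self, (rev_ne_self _).symm]

end newtonPolygon

namespace Weyl1

section reduction

open MvPolynomial

variable {k : Type u} [Field k] {P : Weyl1 k} {i : Fin 2} {w : Fin 2 → ℤ} {n : ℤ}

theorem IsPrincipalSymbol.coeff_symbol {f : MvPolynomial (Fin 2) k} (h : IsPrincipalSymbol w n f P)
    {d : Fin 2 →₀ ℕ} (hd : Finsupp.weight w d = n) : coeff d (symbol k P) = coeff d f := by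
  by_contra hne
  have := mem_weightLE.mp h.symbol_sub_mem d (by rwa [coeff_sub, sub_ne_zero])
  omega

theorem IsPrincipalSymbol.map (hw : 0 < w 0 + w 1) {τ : Weyl1 k →ₐ[k] Weyl1 k}
    {f : MvPolynomial (Fin 2) k} {t : Fin 2 → MvPolynomial (Fin 2) k}
    (ht : ∀ l, IsPrincipalSymbol w (w l) (t l) (τ (![x k, y k] l)))
    (h : IsPrincipalSymbol w n f P) : IsPrincipalSymbol w n (aeval t f) (τ P) where
  isWeightedHomogeneous :=
    isWeightedHomogeneous_aeval (fun l => (ht l).isWeightedHomogeneous) h.isWeightedHomogeneous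
  symbol_sub_mem := by
    have := add_mem (symbol_map_sub_aeval_mem_weightLE hw (ht 0) (ht 1) h.symbol_mem)
      (aeval_mem_weightLE (fun l => (ht l).isWeightedHomogeneous) h.symbol_sub_mem)
    simpa using this

variable [CharZero k] (hP : IsLocallyNilpotent (ad P))

include hP in
-- If all leading monomials involve `X i`, then so does the leading form, which therefore cannot
-- involve the other variable.
theorem apply_rev_eq_zero_of_weight_eq (hw : 0 < w 0 + w 1) (hn : symbol k P ∈ weightLE k w n)
    (h : ∀ d, coeff d (symbol k P) ≠ 0 → Finsupp.weight w d = n → d i ≠ 0) {d : Fin 2 →₀ ℕ}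
    (hd : coeff d (symbol k P) ≠ 0) (hdn : Finsupp.weight w d = n) : d i.rev = 0 := by
  have hf := IsPrincipalSymbol.weightedHomogeneousComponent hn
  rw [hf.coeff_symbol hdn] at hd
  refine eq_zero_of_pderiv_eq_zero
    (pderiv_rev_eq_zero_of_X_dvd (hf.isLocallyNilpotent_poisson hw hP) ?_) hd
  refine X_dvd_of_forall_coeff fun d hd => ?_
  have hdn := hf.isWeightedHomogeneous hd
  exact h d (by rwa [hf.coeff_symbol hdn]) hdn

include hP in
theorem coeff_single_degreeOf_ne_zero (hi : 0 < degreeOf i (symbol k P)) :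
    coeff (Finsupp.single i (degreeOf i (symbol k P))) (symbol k P) ≠ 0 := by
  have weight_eq (d : Fin 2 →₀ ℕ) : Finsupp.weight (Pi.single i 1 : Fin 2 → ℤ) d = d i := by
    simp [weight_eq_add_rev i, rev_ne_self]
  have hne : symbol k P ≠ 0 := fun h => by simp [h] at hi
  obtain ⟨d, hd, hdi⟩ := exists_coeff_ne_zero_apply_eq_degreeOf hne i
  have rev_eq_zero : d i.rev = 0 := by
    refine apply_rev_eq_zero_of_weight_eq hP (w := Pi.single i 1) (n := degreeOf i (symbol k P))
      ?_ (mem_weightLE.mpr fun d hd => ?_) (fun d _ h => ?_) hd ?_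
    · rw [← Fin.sum_univ_two, Fintype.sum_pi_single']
      exact one_pos
    · rw [weight_eq]
      exact mod_cast monomial_le_degreeOf i (mem_support_iff.mpr hd)
    · rw [weight_eq] at h
      omega
    · rw [weight_eq, hdi]
  rwa [← hdi, ← eq_single_of_rev_eq_zero rev_eq_zero]

variable (hpos : ∀ l, 0 < degreeOf l (symbol k P))

include hP hpos in
theorem symbol_mem_weightLE_edgeDegree :
    symbol k P ∈ weightLE k (edgeWeight (symbol k P)) (edgeDegree (symbol k P)) := by
  have hne : symbol k P ≠ 0 := fun h => by simpa [h] using hpos 0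
  obtain ⟨d, hd, hmax⟩ := Finset.exists_max_image _ (Finsupp.weight (edgeWeight (symbol k P)))
    (support_nonempty.mpr hne)
  refine mem_weightLE.mpr fun d' hd' => (hmax d' (mem_support_iff.mpr hd')).trans ?_
  by_contra! hlt
  have le_degreeOf (l) {d} (hd : coeff d (symbol k P) ≠ 0) : d l ≤ degreeOf l (symbol k P) :=
    monomial_le_degreeOf l (mem_support_iff.mpr hd)
  have hd := mem_support_iff.mp hd
  have rev_eq_zero : d (0 : Fin 2).rev = 0 := by
    refine apply_rev_eq_zero_of_weight_eq hP (edgeWeight_zero_add_one_pos hpos)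
      (mem_weightLE.mpr fun d hd => hmax d (mem_support_iff.mpr hd)) (fun d' hd' h h0 => ?_) hd rfl
    rw [← h, weight_edgeWeight 0, edgeDegree_eq 0, h0] at hlt
    norm_cast at hlt
    have := Nat.mul_le_mul_right (degreeOf 0 (symbol k P)) (le_degreeOf (Fin.rev 0) hd')
    linarith
  rw [weight_edgeWeight 0, edgeDegree_eq 0, rev_eq_zero] at hlt
  norm_cast at hlt
  have := Nat.mul_le_mul_right (degreeOf (Fin.rev 0) (symbol k P)) (le_degreeOf 0 hd)
  linarith

include hP hpos in
theorem isPrincipalSymbol_edgeForm : IsPrincipalSymbol (edgeWeight (symbol k P))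
    (edgeDegree (symbol k P)) (edgeForm (symbol k P)) P :=
  .weightedHomogeneousComponent (symbol_mem_weightLE_edgeDegree hP hpos)

include hP hpos in
theorem exists_root_edgeForm : ∃ (i : Fin 2) (r : k) (e : ℕ),
    degreeOf i.rev (symbol k P) = degreeOf i (symbol k P) * e ∧
      eval (Function.update (Pi.single i.rev 1) i r) (edgeForm (symbol k P)) = 0 := by
  have hf := (isPrincipalSymbol_edgeForm hP hpos).isLocallyNilpotent_poisson
    (edgeWeight_zero_add_one_pos hpos) hP
  have coeff_ne_zero (i) :
      coeff (Finsupp.single i (degreeOf i (symbol k P))) (edgeForm (symbol k P)) ≠ 0 := by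
    rw [coeff_edgeForm_single]
    exact coeff_single_degreeOf_ne_zero hP (hpos i)
  have pderiv_ne_zero (i) : pderiv i (edgeForm (symbol k P)) ≠ 0 := fun h =>
    (hpos i).ne' (by simpa using eq_zero_of_pderiv_eq_zero h (coeff_ne_zero i))
  obtain ⟨i, hi⟩ := exists_not_X_dvd_pderiv hf pderiv_ne_zero
  obtain ⟨e, he⟩ := degreeOf_dvd_of_not_X_dvd_pderiv_edgeForm hi
  have he0 : 0 < e := Nat.pos_of_mul_pos_left (he ▸ hpos i.rev)
  obtain ⟨r, hr⟩ := exists_eval_eq_zero hf (pderiv_ne_zero i) (hpos i) he0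
    (isWeightedHomogeneous_edgeForm_update (hpos i) he) (coeff_ne_zero i)
  exact ⟨i, r, e, he, hr⟩

include hP hpos in
theorem isPrincipalSymbol_shear {r : k} {e : ℕ}
    (he : degreeOf i.rev (symbol k P) = degreeOf i (symbol k P) * e) {τ : Weyl1 k →ₐ[k] Weyl1 k}
    (hτ : ∀ l, symbol k (τ (![x k, y k] l)) =
      Function.update X i (X i + C r * X i.rev ^ e) l) :
    IsPrincipalSymbol (edgeWeight (symbol k P)) (edgeDegree (symbol k P))
      (aeval (Function.update X i (X i + C r * X i.rev ^ e)) (edgeForm (symbol k P))) (τ P) := by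
  refine (isPrincipalSymbol_edgeForm hP hpos).map (edgeWeight_zero_add_one_pos hpos) fun l =>
    .of_symbol_eq ?_ (hτ l)
  obtain rfl | rfl := eq_or_eq_rev i l
  · rw [Function.update_self]
    refine (isWeightedHomogeneous_X k _ _).add ?_
    have h := (isWeightedHomogeneous_C (edgeWeight (symbol k P)) r).mul
      ((isWeightedHomogeneous_X k (edgeWeight (symbol k P)) l.rev).pow e)
    convert h using 1
    simp [edgeWeight, he, mul_comm]
  · rw [Function.update_of_ne (rev_ne_self i)]
    exact isWeightedHomogeneous_X ..

theorem exists_degreeOf_lt {φ : Weyl1 k ≃ₐ[k] Weyl1 k}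
    (hpos : ∀ l, 0 < degreeOf l (symbol k (φ (x k)))) :
    ∃ ψ ∈ (descend k).range, ∃ i : Fin 2,
      degreeOf i (symbol k ((ψ * φ) (x k))) ≤ degreeOf i (symbol k (φ (x k))) ∧
      degreeOf i.rev (symbol k ((ψ * φ) (x k))) < degreeOf i.rev (symbol k (φ (x k))) := by
  have hP := isLocallyNilpotent_ad_map_x φ
  obtain ⟨i, r, e, he, hr⟩ := exists_root_edgeForm hP hpos
  obtain ⟨ψ, hψ, symbol_ψ⟩ := exists_shear i r e
  have principal := isPrincipalSymbol_shear hP hpos he (τ := ψ) symbol_ψ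
  have degreeOf_le (l) := degreeOf_le_of_mem_weightLE (i := l) (hpos l.rev) principal.symbol_mem
  refine ⟨ψ, hψ, i, degreeOf_le i, (degreeOf_le i.rev).lt_of_ne fun
    (h : degreeOf i.rev (symbol k ((ψ * φ) (x k))) = _) => ?_⟩
  have vertex_ne_zero := coeff_single_degreeOf_ne_zero (isLocallyNilpotent_ad_map_x (ψ * φ))
    (i := i.rev) (h ▸ hpos i.rev)
  rw [h] at vertex_ne_zero
  refine vertex_ne_zero ((principal.coeff_symbol (weight_edgeWeight_single _)).trans ?_)
  rw [← eval_single_one_of_isWeightedHomogeneous (Int.natCast_ne_zero.mpr (hpos _).ne')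
    principal.isWeightedHomogeneous (weight_edgeWeight_single _), eval_single_aeval_update, hr]

theorem descend_surjective : Function.Surjective (descend k) := by
  suffices ∀ (n : ℕ) (φ : Weyl1 k ≃ₐ[k] Weyl1 k),
      degreeOf 0 (symbol k (φ (x k))) + degreeOf 1 (symbol k (φ (x k))) = n →
      φ ∈ (descend k).range from fun φ => this _ φ rfl
  intro n
  induction n using Nat.strong_induction_on with
  | _ n ih =>
    rintro φ rfl
    by_cases hpos : ∀ l, 0 < degreeOf l (symbol k (φ (x k)))
    · obtain ⟨ψ, hψ, i, hle, hlt⟩ := exists_degreeOf_lt hpos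
      refine (Subgroup.mul_mem_cancel_left _ hψ).mp (ih _ ?_ (ψ * φ) rfl)
      rw [← Fin.sum_univ_two (fun l => degreeOf l _), ← Fin.sum_univ_two (fun l => degreeOf l _),
        sum_eq_add_rev i, sum_eq_add_rev i]
      exact add_lt_add_of_le_of_lt hle hlt
    · push Not at hpos
      obtain ⟨l, hl⟩ := hpos
      have mem := mem_adjoin_of_support (i := l.rev) (a := φ (x k)) fun m hm => by
        have := monomial_le_degreeOf l hm
        rw [Fin.rev_rev]
        omega
      fin_cases l
      exacts [mem_range_descend_of_map_x_mem_adjoin_y mem,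
        mem_range_descend_of_map_x_mem_adjoin_x mem]

end reduction

end Weyl1

theorem mainTheorem8 (k : Type u) [Field k] [CharZero k] :
    -- `(F₂, {{-,-}}, [x, y])` is a Hamiltonian algebra
    (F2.bracket k).IsPoisson ∧ (F2.bracket k).IsMomentMap (F2.moment k) ∧
    -- every Hamiltonian automorphism descends to `A₁`, and the resulting group homomorphism
    -- `HAut(F₂) → Aut(A₁)` is surjective
    ∃ π : (F2.bracket k).hamiltonianAut (F2.moment k) →* (Weyl1 k ≃ₐ[k] Weyl1 k),
      (∀ (φ : (F2.bracket k).hamiltonianAut (F2.moment k)) (a : F2 k),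
        π φ (Weyl1.mk k a) = Weyl1.mk k ((φ : F2 k ≃ₐ[k] F2 k) a)) ∧
      Function.Surjective π :=
  ⟨F2.isPoisson_bracket k, F2.isMomentMap_moment k, Weyl1.descend k, Weyl1.descend_mk,
    Weyl1.descend_surjective⟩
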